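/- **Conventions.** A dyadic interval is $[j2^n,(j+1)2^n)$ with $n,j\in\mathbb Z$; a dyadic rectangle $R=I\times J\subset\mathbb R^2$ is a product of two dyadic intervals, with area $|R|$. Put $h_I=|I|^{-1/2}(\mathbf 1_{I_{\rm left}}-\mathbf 1_{I_{\rm right}})$ and $h_{I\times J}=h_I\otimes h_J$. For real $\sigma=(\sigma_R)_R$ with $|\sigma_R|\le 1$ the bi-parameter martingale transform is $T_\sigma f=\sum_R\sigma_R\langle f,h_R\rangle h_R$, where $f$ may be a function or a finite measure. Let $\operatorname{dist}_{\mathbb H}(p,q)=\inf\{|R|^{1/2}: R \text{ a dyadic rectangle},\ p,q\in R\}$. For a finite non-empty $F\subset\mathbb R^2$ let $\mu_F=\frac1{\#F}\sum_{p\in F}\delta_p$. A collection $\mathcal S$ of dyadic rectangles is $\eta$-sparse if there are pairwise disjoint measurable sets $E(R)\subseteq R$, $R\in\mathcal S$, with $|E(R)|\ge\eta|R|$. Write $\langle |f|\rangle_R=\frac1{|R|}\int_R|f|$. A *$\mathcal P$-set of order $m$* is a set $\mathcal P\subset[0,1)^2$ with $\#\mathcal P=2^{2m+1}$ and $\operatorname{dist}_{\mathbb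 H}(p,q)\ge 2^{-m}$ for all $p\ne q$ in $\mathcal P$. Given such a $\mathcal P$, an integer $k$ and a constant $A>0$, a *$\mathcal Z$-set with constant $A$* is a finite set $\mathcal Z\subset[0,1)^2$ such that 1. $m2^{2m}\le A\,\#\mathcal Z$; 2. for every $z\in\mathcal Z$ there is exactly one $p(z)\in\mathcal P$ with $\operatorname{dist}_{\mathbb H}(p(z),z)^2<2^{-2m-1}$; 3. $A^{-1}2^{-2m-k}\le\operatorname{dist}_{\mathbb H}(p(z),z)^2\le A2^{-2m-k}$ for every $z\in\mathcal Z$; 4. $\#(R\cap\mathcal Z)\le Ak$ for every dyadic rectangle $R$ with $|R|\le 2^{-2m-2}$ and $R\cap\mathcal P\neq\emptyset$; 5. $\#(R\cap\mathcal Z)\le A\,2^{2m}mk|R|$ for every dyadic rectangle $R$ with $|R|\ge 2^{-2m-1}$. **Theorem.** (a) For every integer $m\ge0$ there is a $\mathcal P$-set of order $m$, and there is an absolute constant $A>0$ such that for all integers $1\le k\le m$ and every $\mathcal P$-set $\mathcal P$ of order $m$ there is a $\mathcal Z$-set with constant $A$. (b) For every $A>0$ there is $c>0$, depending only on $A$,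 such that for all integers $1\le k\le m$, every $\mathcal P$-set $\mathcal P$ of order $m$ and every $\mathcal Z$-set $\mathcal Z$ for $\mathcal P$ and $k$ with constant $A$, the measures $\mu=\mu_{\mathcal P}$ and $\nu=\mu_{\mathcal Z}$ admit a sequence $\sigma$ with $|\sigma_R|\le1$ and only finitely many non-zero terms such that $$|\langle T_\sigma\mu,\nu\rangle|=\Bigl|\int T_\sigma\mu\,d\nu\Bigr|\ge c\,2^k .$$ (c) Consequently bi-parameter martingale transforms admit no uniform $(1,1)$ sparse domination: for all $C>0$ and $\eta>0$ there are a sequence $\sigma$ with $|\sigma_R|\le1$ and only finitely many non-zero terms, and bounded, integrable, compactly supported $f,g:\mathbb R^2\to\mathbb R$, such that for every $\eta$-sparse collection $\mathcal S$ of dyadic rectangles $$|\langle T_\sigma f,g\rangle|>C\sum_{R\in\mathcal S}\langle|f|\rangle_R\langle|g|\rangle_R|R| .$$ -/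

import Mathlib

open MeasureTheory
open scoped ENNReal

noncomputable section

namespace BiParam

/-- A dyadic interval of the real line, coded by its scale `n` and its position `j`:
it stands for `[j 2^n, (j+1) 2^n)`. Different codes give different intervals. -/
@[ext]
structure DyadicInterval where
  scale : ℤ
  pos : ℤ

namespace DyadicInterval

/-- The length `2^n`. -/
def len (I : DyadicInterval) : ℝ := (2 : ℝ) ^ I.scale

/-- The half-open interval itself. -/
def toSet (I : DyadicInterval) : Set ℝ :=
  Set.Ico ((I.pos : ℝ) * I.len) (((I.pos : ℝ) + 1) * I.len)

/-- The left half. -/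
def leftHalf (I : DyadicInterval) : Set ℝ :=
  Set.Ico ((I.pos : ℝ) * I.len) (((I.pos : ℝ) + 1 / 2) * I.len)

/-- The right half. -/
def rightHalf (I : DyadicInterval) : Set ℝ :=
  Set.Ico (((I.pos : ℝ) + 1 / 2) * I.len) (((I.pos : ℝ) + 1) * I.len)

/-- The `L²`-normalized Haar function `h_I = |I|^{-1/2} (1_{left half} - 1_{right half})`. -/
def haar (I : DyadicInterval) (x : ℝ) : ℝ :=
  (Real.sqrt I.len)⁻¹ *
    (I.leftHalf.indicator (fun _ => (1 : ℝ)) x - I.rightHalf.indicator (fun _ => (1 : ℝ)) x)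

theorem len_pos (I : DyadicInterval) : 0 < I.len := by
  unfold len; positivity

theorem volume_toSet (I : DyadicInterval) : volume I.toSet = ENNReal.ofReal I.len := by
  unfold toSet
  rw [Real.volume_Ico]
  congr 1
  ring

end DyadicInterval

/-- A dyadic rectangle `I × J` in the plane, with sides parallel to the axes. -/
@[ext]
structure DyadicRectangle where
  fst : DyadicInterval
  snd : DyadicInterval

namespace DyadicRectangle

/-- The rectangle as a subset of the plane. -/
def toSet (R : DyadicRectangle) : Set (ℝ × ℝ) := R.fst.toSet ×ˢ R.snd.toSet

/-- The area `|R| = |I| |J|`. -/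
def area (R : DyadicRectangle) : ℝ := R.fst.len * R.snd.len

/-- The bi-parameter Haar function `h_R (x, y) = h_I x * h_J y`. -/
def haar (R : DyadicRectangle) (x : ℝ × ℝ) : ℝ := R.fst.haar x.1 * R.snd.haar x.2

/-- `area` is Lebesgue measure. -/
theorem volume_toSet (R : DyadicRectangle) : volume R.toSet = ENNReal.ofReal R.area := by
  unfold toSet area
  rw [Measure.volume_eq_prod, Measure.prod_prod, DyadicInterval.volume_toSet,
    DyadicInterval.volume_toSet, ENNReal.ofReal_mul R.fst.len_pos.le]

end DyadicRectangle

/-- The unit square `[0,1)²`. -/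
def unitSquare : Set (ℝ × ℝ) := Set.Ico (0 : ℝ) 1 ×ˢ Set.Ico (0 : ℝ) 1

/-- `dist_H (p, q)`: the infimum of `|R|^{1/2}` over the dyadic rectangles `R` that contain
both `p` and `q`. -/
def distH (p q : ℝ × ℝ) : ℝ :=
  sInf {s : ℝ | ∃ R : DyadicRectangle, p ∈ R.toSet ∧ q ∈ R.toSet ∧ s = Real.sqrt R.area}

/-- The uniform probability measure on a finite set of points. -/
def uniformMeasure (F : Finset (ℝ × ℝ)) : Measure (ℝ × ℝ) :=
  (F.card : ℝ≥0∞)⁻¹ • ∑ p ∈ F, Measure.dirac p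

/-- `P ⊆ [0,1)²` is `2^{-m}`-separated with respect to `dist_H` and has `2^{2m+1}` points. -/
structure IsPSet (m : ℕ) (P : Finset (ℝ × ℝ)) : Prop where
  mem_unitSquare : ∀ p ∈ P, p ∈ unitSquare
  separated : ∀ p ∈ P, ∀ q ∈ P, p ≠ q → (1 / 2 : ℝ) ^ m ≤ distH p q
  card_eq : P.card = 2 ^ (2 * m + 1)

/-- The companion set `Z` of `P` with parameters `k` and `m`; the number `A` controls all the
implied constants. -/
structure IsZSet (A : ℝ) (k m : ℕ) (P Z : Finset (ℝ × ℝ)) : Prop where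
  mem_unitSquare : ∀ z ∈ Z, z ∈ unitSquare
  /-- `Z` has at least about `m 2^{2m}` points. -/
  card_ge : (m : ℝ) * 2 ^ (2 * m) ≤ A * (Z.card : ℝ)
  /-- Each `z` has exactly one point `p(z)` of `P` close to it. -/
  existsUnique_near : ∀ z ∈ Z, ∃! p, p ∈ P ∧ distH p z ^ 2 < (1 / 2 : ℝ) ^ (2 * m + 1)
  /-- That point satisfies `dist_H (p(z), z)² ∼ 2^{-2m-k}`. -/
  dist_near : ∀ z ∈ Z, ∀ p ∈ P, distH p z ^ 2 < (1 / 2 : ℝ) ^ (2 * m + 1) →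
    A⁻¹ * (1 / 2 : ℝ) ^ (2 * m + k) ≤ distH p z ^ 2 ∧
      distH p z ^ 2 ≤ A * (1 / 2 : ℝ) ^ (2 * m + k)
  /-- Small dyadic rectangles that meet `P` contain at most about `k` points of `Z`. -/
  card_small : ∀ R : DyadicRectangle, R.area ≤ (1 / 2 : ℝ) ^ (2 * m + 2) →
    (∃ p ∈ P, p ∈ R.toSet) → (((Z : Set (ℝ × ℝ)) ∩ R.toSet).ncard : ℝ) ≤ A * k
  /-- Large dyadic rectangles `R` contain at most about `2^{2m} m k |R|` points of `Z`. -/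
  card_large : ∀ R : DyadicRectangle, (1 / 2 : ℝ) ^ (2 * m + 1) ≤ R.area →
    (((Z : Set (ℝ × ℝ)) ∩ R.toSet).ncard : ℝ) ≤ A * (2 ^ (2 * m) * m * k * R.area)

/-- The bi-parameter martingale transform of a measure,
`T_σ μ = ∑_R σ_R ⟨μ, h_R⟩ h_R`. It is used below for finitely supported `σ`, where the sum is
finite. -/
def transformMeasure (σ : DyadicRectangle → ℝ) (μ : Measure (ℝ × ℝ)) (x : ℝ × ℝ) : ℝ :=
  ∑' R : DyadicRectangle, σ R * (∫ y, R.haar y ∂μ) * R.haar x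

/-- The bi-parameter martingale transform of a function,
`T_σ f = ∑_R σ_R ⟨f, h_R⟩ h_R`. -/
def transform (σ : DyadicRectangle → ℝ) (f : ℝ × ℝ → ℝ) (x : ℝ × ℝ) : ℝ :=
  ∑' R : DyadicRectangle, σ R * (∫ y, f y * R.haar y) * R.haar x

/-- A collection of dyadic rectangles is `η`-sparse if its members `R` have pairwise disjoint
measurable subsets `E(R)` with `|E(R)| ≥ η |R|`. -/
def IsSparse (η : ℝ) (S : Set DyadicRectangle) : Prop :=
  ∃ E : DyadicRectangle → Set (ℝ × ℝ),
    (∀ R ∈ S, MeasurableSet (E R) ∧ E R ⊆ R.toSet ∧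
      ENNReal.ofReal η * volume R.toSet ≤ volume (E R)) ∧
    S.PairwiseDisjoint E

/-- The average `⟨|f|⟩_R`. -/
def average (f : ℝ × ℝ → ℝ) (R : DyadicRectangle) : ℝ≥0∞ :=
  (volume R.toSet)⁻¹ * ∫⁻ x in R.toSet, ‖f x‖ₑ

/-- The `(1,1)` sparse form `∑_{R ∈ S} ⟨|f|⟩_R ⟨|g|⟩_R |R|`. -/
def sparseForm (S : Set DyadicRectangle) (f g : ℝ × ℝ → ℝ) : ℝ≥0∞ :=
  ∑' R : S, average f R * average g R * volume (R : DyadicRectangle).toSet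

end BiParam

end

namespace BiParam

/-! A $\mathcal P$-set is a digital net: separation and cardinality force exactly one point into
each dyadic rectangle of area $2^{-2m-1}$ in the unit square (`IsPSet.isNet`). Hammersley points
provide an example. For $\mathcal Z$, each $p\in\mathcal P$ receives one companion for each of about
$m$ shapes $(i,j)$ with $i+j=2m+k+1$: a point sharing with $p$ exactly the cells of levels up to $i$
and $j$. Its binary digits are chosen one by one so that it avoids every other net point
(`IsNet.exists_companion`). Two companions of the same shape share a cell of area $2^{-2m-2}$ only
if they belong to the same $p$ (`IsNet.companion_cell`), which yields the counting bounds.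

For the lower bound, $h_R(p)h_R(z)=\pm|R|^{-1}$ when $R$ contains both points. The smallest such
rectangle has sign $+$; a minus sign occurs only when exactly one side is minimal. Weighting by
$\sigma_R\sim 2^{-2m-k}|R|^{-1}$ makes the sum geometric, and the smallest rectangle beats all
negative terms (`le_sum_haar`). With only areas at most $2^{-2m-2}$ in use, $p(z)$ is the only point
of $\mathcal P$ that interacts with $z$. It contributes about $2^{2m+k}$, and division by
$\#\mathcal P=2^{2m+1}$ leaves $2^k$ (`le_integral_transformMeasure`).

For sparse forms, $\mu(R)\nu(R)\lesssim k|R|^2$ once $m\ge4^k$ (`IsZSet.card_mul_card_le`). Hence a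
sparse form is $\lesssim k/\eta$, which loses to $2^k$. Spreading the point masses over tiny dyadic
squares changes neither side essentially: the pairing stays exactly the same
(`integral_transform_bump`) and the bound on the averages survives. -/

/-! ### Dyadic cells coded by floors; level `n` means length `2 ^ (-n)` -/

/-- `x` and `y` lie in the same dyadic interval of length `2 ^ (-n)`. -/
def SameCell (n : ℤ) (x y : ℝ) : Prop := ⌊x * 2 ^ n⌋ = ⌊y * 2 ^ n⌋

namespace SameCell

theorem refl (n : ℤ) (x : ℝ) : SameCell n x x := rfl

theorem symm {n : ℤ} {x y : ℝ} (h : SameCell n x y) : SameCell n y x := Eq.symm h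

theorem trans {n : ℤ} {x y z : ℝ} (h : SameCell n x y) (h' : SameCell n y z) : SameCell n x z :=
  Eq.trans h h'

end SameCell

theorem floor_mul_zpow_sub (x : ℝ) (n : ℤ) (d : ℕ) :
    ⌊x * 2 ^ (n - d)⌋ = ⌊x * 2 ^ n⌋ / (2 ^ d : ℕ) := by
  rw [← Int.floor_div_natCast, zpow_sub₀ two_ne_zero, zpow_natCast]
  push_cast
  rw [mul_div_assoc]

theorem SameCell.mono {n n' : ℤ} {x y : ℝ} (h : SameCell n x y) (hn : n' ≤ n) :
    SameCell n' x y := by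
  obtain ⟨d, hd⟩ := Int.eq_ofNat_of_zero_le (sub_nonneg.2 hn)
  obtain rfl : n' = n - d := by omega
  unfold SameCell at *
  rw [floor_mul_zpow_sub, floor_mul_zpow_sub, h]

theorem sameCell_of_mem_Ico {x y : ℝ} (hx : x ∈ Set.Ico (0 : ℝ) 1) (hy : y ∈ Set.Ico (0 : ℝ) 1)
    {n : ℤ} (hn : n ≤ 0) : SameCell n x y := by
  refine SameCell.mono (n := 0) ?_ hn
  unfold SameCell
  simp only [zpow_zero, mul_one]
  rw [Int.floor_eq_zero_iff.2 hx, Int.floor_eq_zero_iff.2 hy]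

theorem SameCell.mem_Ico {x y : ℝ} {n : ℤ} (h : SameCell n x y) (hn : 0 ≤ n)
    (hy : y ∈ Set.Ico (0 : ℝ) 1) : x ∈ Set.Ico (0 : ℝ) 1 := by
  have h0 := h.mono hn
  unfold SameCell at h0
  simp only [zpow_zero, mul_one] at h0
  rw [Int.floor_eq_zero_iff.2 hy] at h0
  exact Int.floor_eq_zero_iff.1 h0

theorem exists_not_sameCell {x y : ℝ} (h : x ≠ y) : ∃ n : ℕ, ¬ SameCell n x y := by
  obtain ⟨n, hn⟩ := pow_unbounded_of_one_lt (|x - y|⁻¹) (one_lt_two (α := ℝ))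
  refine ⟨n, fun hs => ?_⟩
  have h1 := Int.abs_sub_lt_one_of_floor_eq_floor hs
  rw [zpow_natCast, ← sub_mul, abs_mul, abs_of_pos (by positivity : (0 : ℝ) < 2 ^ n)] at h1
  have h2 : 0 < |x - y| := abs_pos.2 (sub_ne_zero.2 h)
  rw [inv_lt_iff_one_lt_mul₀ h2] at hn
  linarith

/-- The level at which two points part. -/
theorem exists_split {x y : ℝ} (h : x ≠ y) {n : ℤ} (hn : SameCell n x y) :
    ∃ d : ℤ, n ≤ d ∧ SameCell d x y ∧ ¬ SameCell (d + 1) x y := by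
  classical
  obtain ⟨N, hN⟩ := exists_not_sameCell h
  have hex : ∃ t : ℕ, ¬ SameCell (n + t) x y := by
    refine ⟨(N - n).toNat, fun hs => hN (hs.mono ?_)⟩
    have := Int.self_le_toNat (N - n)
    omega
  have h0 : Nat.find hex ≠ 0 := by
    intro h0
    have := Nat.find_spec hex
    rw [h0] at this
    simp at this
    exact this hn
  obtain ⟨t, ht⟩ := Nat.exists_eq_succ_of_ne_zero h0
  refine ⟨n + t, by omega, ?_, ?_⟩
  · exact not_not.1 (Nat.find_min hex (m := t) (by omega))
  · have := Nat.find_spec hex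
    rw [ht] at this
    push_cast at this
    rwa [add_assoc]

theorem SameCell.le_of_split {x y : ℝ} {a d : ℤ} (h : SameCell a x y)
    (hd : ¬ SameCell (d + 1) x y) : a ≤ d := by
  by_contra! hlt
  exact hd (h.mono (by omega))

theorem floor_succ_eq (x : ℝ) (n : ℤ) :
    ⌊x * 2 ^ (n + 1)⌋ / 2 = ⌊x * 2 ^ n⌋ := by
  have := floor_mul_zpow_sub x (n + 1) 1
  simp at this
  rw [this]

/-- A dyadic interval has only two halves. -/
theorem SameCell.halves {x y z : ℝ} {n : ℤ} (hxy : SameCell n x y) (hxz : SameCell n x z)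
    (h : ¬ SameCell (n + 1) x y) : SameCell (n + 1) z x ∨ SameCell (n + 1) z y := by
  unfold SameCell at *
  rw [← floor_succ_eq x n] at hxy hxz
  rw [← floor_succ_eq y n] at hxy
  rw [← floor_succ_eq z n] at hxz
  omega

theorem exists_sibling (x : ℝ) (n : ℤ) : ∃ y, SameCell n y x ∧ ¬ SameCell (n + 1) y x := by
  set c := ⌊x * 2 ^ (n + 1)⌋ with hc
  have key : ∀ e : ℤ, ⌊(x + e * 2 ^ (-(n + 1))) * 2 ^ (n + 1)⌋ = c + e := by
    intro e
    rw [add_mul, mul_assoc, ← zpow_add₀ two_ne_zero, neg_add_cancel, zpow_zero, mul_one,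
      Int.floor_add_intCast]
  rcases Int.emod_two_eq_zero_or_one c with h | h
  · refine ⟨x + (1 : ℤ) * 2 ^ (-(n + 1)), ?_, ?_⟩ <;> unfold SameCell
    · rw [← floor_succ_eq _ n, ← floor_succ_eq x n, key, ← hc]; omega
    · rw [key, ← hc]; omega
  · refine ⟨x + (-1 : ℤ) * 2 ^ (-(n + 1)), ?_, ?_⟩ <;> unfold SameCell
    · rw [← floor_succ_eq _ n, ← floor_succ_eq x n, key, ← hc]; omega
    · rw [key, ← hc]; omega

/-- One of the two halves of a cell always misses `q`. This is the single digit choice behind the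
companion points. -/
theorem exists_avoid (x q : ℝ) (n : ℤ) : ∃ y, SameCell n y x ∧ ¬ SameCell (n + 1) y q := by
  by_cases h : SameCell (n + 1) x q
  · obtain ⟨y, hy, hy'⟩ := exists_sibling x n
    exact ⟨y, hy, fun hq => hy' (hq.trans h.symm)⟩
  · exact ⟨x, .refl _ _, h⟩

/-! ### Intervals, Haar functions and `distH` in terms of cells -/

namespace DyadicInterval

theorem mem_toSet_iff (I : DyadicInterval) (x : ℝ) :
    x ∈ I.toSet ↔ ⌊x * 2 ^ (-I.scale)⌋ = I.pos := by
  have h : (0 : ℝ) < 2 ^ I.scale := by positivity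
  rw [Int.floor_eq_iff, zpow_neg, ← div_eq_mul_inv, le_div_iff₀ h, div_lt_iff₀ h]
  rfl

/-- The dyadic interval of length `2 ^ (-n)` around `x`. -/
noncomputable def around (n : ℤ) (x : ℝ) : DyadicInterval := ⟨-n, ⌊x * 2 ^ n⌋⟩

theorem mem_around {n : ℤ} {x y : ℝ} : y ∈ (around n x).toSet ↔ SameCell n y x := by
  rw [mem_toSet_iff]
  simp [around, SameCell]

theorem around_of_mem {I : DyadicInterval} {x : ℝ} (h : x ∈ I.toSet) :
    around (-I.scale) x = I := by
  rw [mem_toSet_iff] at h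
  ext
  · simp [around]
  · simpa [around] using h

theorem sameCell_of_mem {I : DyadicInterval} {x y : ℝ} (hx : x ∈ I.toSet) (hy : y ∈ I.toSet) :
    SameCell (-I.scale) x y := by
  rw [mem_toSet_iff] at hx hy
  exact hx.trans hy.symm

theorem mem_of_sameCell {I : DyadicInterval} {x y : ℝ} (hx : SameCell (-I.scale) x y)
    (hy : y ∈ I.toSet) : x ∈ I.toSet := by
  rw [mem_toSet_iff] at hy ⊢
  exact Eq.trans hx hy

theorem mem_leftHalf_iff (I : DyadicInterval) (x : ℝ) :
    x ∈ I.leftHalf ↔ ⌊x * 2 ^ (-I.scale + 1)⌋ = 2 * I.pos := by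
  have h : (0 : ℝ) < 2 ^ I.scale := by positivity
  rw [Int.floor_eq_iff, zpow_add₀ two_ne_zero, zpow_neg, zpow_one, ← mul_assoc, ← div_eq_mul_inv,
    div_mul_eq_mul_div, le_div_iff₀ h, div_lt_iff₀ h]
  simp only [leftHalf, Set.mem_Ico, len]
  push_cast
  constructor <;> rintro ⟨h1, h2⟩ <;> constructor <;> linarith

theorem mem_rightHalf_iff (I : DyadicInterval) (x : ℝ) :
    x ∈ I.rightHalf ↔ ⌊x * 2 ^ (-I.scale + 1)⌋ = 2 * I.pos + 1 := by
  have h : (0 : ℝ) < 2 ^ I.scale := by positivity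
  rw [Int.floor_eq_iff, zpow_add₀ two_ne_zero, zpow_neg, zpow_one, ← mul_assoc, ← div_eq_mul_inv,
    div_mul_eq_mul_div, le_div_iff₀ h, div_lt_iff₀ h]
  simp only [rightHalf, Set.mem_Ico, len]
  push_cast
  constructor <;> rintro ⟨h1, h2⟩ <;> constructor <;> linarith

theorem haar_of_notMem {I : DyadicInterval} {x : ℝ} (h : x ∉ I.toSet) : I.haar x = 0 := by
  rw [mem_toSet_iff, ← floor_succ_eq] at h
  have h1 : x ∉ I.leftHalf := by rw [mem_leftHalf_iff]; omega
  have h2 : x ∉ I.rightHalf := by rw [mem_rightHalf_iff]; omega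
  simp [haar, h1, h2]

theorem haar_eq_of_mem {I : DyadicInterval} {x : ℝ} (h : x ∈ I.toSet) :
    I.haar x = (Real.sqrt I.len)⁻¹ *
      (if ⌊x * 2 ^ (-I.scale + 1)⌋ = 2 * I.pos then 1 else -1) := by
  rw [mem_toSet_iff, ← floor_succ_eq] at h
  rw [haar]
  congr 1
  split_ifs with hl
  · have h1 : x ∈ I.leftHalf := by rw [mem_leftHalf_iff]; omega
    have h2 : x ∉ I.rightHalf := by rw [mem_rightHalf_iff]; omega
    simp [h1, h2]
  · have h1 : x ∉ I.leftHalf := by rw [mem_leftHalf_iff]; omega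
    have h2 : x ∈ I.rightHalf := by rw [mem_rightHalf_iff]; omega
    simp [h1, h2]

theorem haar_congr {I : DyadicInterval} {x y : ℝ} (h : SameCell (-I.scale + 1) x y) :
    I.haar x = I.haar y := by
  by_cases hy : y ∈ I.toSet
  · have hx := mem_of_sameCell (h.mono (by omega)) hy
    rw [haar_eq_of_mem hx, haar_eq_of_mem hy, h]
  · have hx : x ∉ I.toSet := fun hx => hy (mem_of_sameCell (h.symm.mono (by omega)) hx)
    rw [haar_of_notMem hx, haar_of_notMem hy]

theorem haar_mul_self {I : DyadicInterval} {x : ℝ} (h : x ∈ I.toSet) :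
    I.haar x * I.haar x = 2 ^ (-I.scale) := by
  have hs : (Real.sqrt I.len)⁻¹ * (Real.sqrt I.len)⁻¹ = 2 ^ (-I.scale) := by
    rw [← mul_inv, Real.mul_self_sqrt I.len_pos.le, zpow_neg]; rfl
  rw [haar_eq_of_mem h, mul_mul_mul_comm, hs]
  split_ifs <;> simp

theorem haar_mul_of_split {I : DyadicInterval} {x y : ℝ} (hx : x ∈ I.toSet) (hy : y ∈ I.toSet)
    (h : ¬ SameCell (-I.scale + 1) x y) :
    I.haar x * I.haar y = -2 ^ (-I.scale) := by
  rw [← haar_mul_self hx]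
  have : I.haar y = -I.haar x := by
    rw [haar_eq_of_mem hx, haar_eq_of_mem hy]
    rw [mem_toSet_iff, ← floor_succ_eq] at hx hy
    unfold SameCell at h
    split_ifs <;> first | omega | ring
  rw [this]; ring

end DyadicInterval

namespace DyadicRectangle

/-- The dyadic rectangle with sides `2 ^ (-a)` and `2 ^ (-b)` around `x`. -/
noncomputable def around (a b : ℤ) (x : ℝ × ℝ) : DyadicRectangle :=
  ⟨DyadicInterval.around a x.1, DyadicInterval.around b x.2⟩

theorem mem_around {a b : ℤ} {x y : ℝ × ℝ} :
    y ∈ (around a b x).toSet ↔ SameCell a y.1 x.1 ∧ SameCell b y.2 x.2 := by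
  simp [toSet, around, Set.mem_prod, DyadicInterval.mem_around]

theorem area_eq (R : DyadicRectangle) : R.area = 2 ^ (-(-R.fst.scale + -R.snd.scale)) := by
  rw [area, DyadicInterval.len, DyadicInterval.len, ← zpow_add₀ two_ne_zero]
  congr 1; ring

theorem area_around (a b : ℤ) (x : ℝ × ℝ) : (around a b x).area = 2 ^ (-(a + b)) := by
  rw [area_eq]; simp [around, DyadicInterval.around, add_comm]

theorem area_pos (R : DyadicRectangle) : 0 < R.area :=
  mul_pos R.fst.len_pos R.snd.len_pos

theorem sameCell_of_mem {R : DyadicRectangle} {x y : ℝ × ℝ} (hx : x ∈ R.toSet)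
    (hy : y ∈ R.toSet) :
    SameCell (-R.fst.scale) x.1 y.1 ∧ SameCell (-R.snd.scale) x.2 y.2 :=
  ⟨DyadicInterval.sameCell_of_mem hx.1 hy.1, DyadicInterval.sameCell_of_mem hx.2 hy.2⟩

end DyadicRectangle

theorem half_pow_eq (n : ℕ) : (1 / 2 : ℝ) ^ n = 2 ^ (-(n : ℤ)) := by
  rw [zpow_neg, zpow_natCast, one_div, inv_pow]

theorem bddBelow_distH (p q : ℝ × ℝ) :
    BddBelow {s : ℝ | ∃ R : DyadicRectangle, p ∈ R.toSet ∧ q ∈ R.toSet ∧ s = Real.sqrt R.area} :=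
  ⟨0, by rintro s ⟨R, -, -, rfl⟩; exact Real.sqrt_nonneg _⟩

theorem distH_nonneg (p q : ℝ × ℝ) : 0 ≤ distH p q :=
  Real.sInf_nonneg (by rintro s ⟨R, -, -, rfl⟩; exact Real.sqrt_nonneg _)

theorem distH_sq_le_area {p q : ℝ × ℝ} {R : DyadicRectangle} (hp : p ∈ R.toSet)
    (hq : q ∈ R.toSet) : distH p q ^ 2 ≤ R.area := by
  have : distH p q ≤ Real.sqrt R.area := csInf_le (bddBelow_distH p q) ⟨R, hp, hq, rfl⟩
  calc distH p q ^ 2 ≤ Real.sqrt R.area ^ 2 := by gcongr; exact distH_nonneg p q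
    _ = R.area := Real.sq_sqrt R.area_pos.le

theorem distH_sq_le_of_sameCell {p q : ℝ × ℝ} {a b : ℤ} (h1 : SameCell a p.1 q.1)
    (h2 : SameCell b p.2 q.2) : distH p q ^ 2 ≤ 2 ^ (-(a + b)) := by
  rw [← DyadicRectangle.area_around a b q]
  exact distH_sq_le_area (DyadicRectangle.mem_around.2 ⟨h1, h2⟩)
    (DyadicRectangle.mem_around.2 ⟨.refl _ _, .refl _ _⟩)

/-- Needed for lower bounds on `distH`: the real `sInf` of the empty set is `0`, so points without a
common dyadic rectangle would get distance `0`. -/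
theorem nonempty_distH {p q : ℝ × ℝ} (hp : p ∈ unitSquare) (hq : q ∈ unitSquare) :
    {s : ℝ | ∃ R : DyadicRectangle, p ∈ R.toSet ∧ q ∈ R.toSet ∧ s = Real.sqrt R.area}.Nonempty :=
  ⟨_, DyadicRectangle.around 0 0 q,
    DyadicRectangle.mem_around.2 ⟨sameCell_of_mem_Ico hp.1 hq.1 le_rfl,
      sameCell_of_mem_Ico hp.2 hq.2 le_rfl⟩,
    DyadicRectangle.mem_around.2 ⟨.refl _ _, .refl _ _⟩, rfl⟩

/-- `dist_H` is bounded below by `2 ^ (-n / 2)` when no smaller rectangle holds both points. -/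
theorem le_distH_sq {p q : ℝ × ℝ} (hp : p ∈ unitSquare) (hq : q ∈ unitSquare) {n : ℤ}
    (h : ∀ a b : ℤ, SameCell a p.1 q.1 → SameCell b p.2 q.2 → a + b ≤ n) :
    (2 : ℝ) ^ (-n) ≤ distH p q ^ 2 := by
  have : Real.sqrt (2 ^ (-n)) ≤ distH p q := by
    refine le_csInf (nonempty_distH hp hq) ?_
    rintro s ⟨R, hpR, hqR, rfl⟩
    apply Real.sqrt_le_sqrt
    rw [R.area_eq]
    have := DyadicRectangle.sameCell_of_mem hpR hqR
    exact zpow_le_zpow_right₀ one_le_two (neg_le_neg (h _ _ this.1 this.2))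
  calc (2 : ℝ) ^ (-n) = Real.sqrt (2 ^ (-n)) ^ 2 := (Real.sq_sqrt (by positivity)).symm
    _ ≤ _ := by gcongr

theorem exists_sameCell_of_distH_sq_lt {p q : ℝ × ℝ} (hp : p ∈ unitSquare) (hq : q ∈ unitSquare)
    {n : ℤ} (h : distH p q ^ 2 < 2 ^ (-n)) :
    ∃ a b : ℤ, SameCell a p.1 q.1 ∧ SameCell b p.2 q.2 ∧ n + 1 ≤ a + b := by
  by_contra! hc
  exact absurd (le_distH_sq hp hq (n := n) fun a b h1 h2 => by
    have := hc a b h1 h2; omega) (not_le.2 h)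

/-! ### Nets and counting in cells -/

section Counting

variable {α : Type*}

open Classical in
/-- If every cell of sides `2 ^ (-(r + d))`, `2 ^ (-s)` holds at most `F` points, then a cell of
sides `2 ^ (-r)`, `2 ^ (-s)` holds at most `F * 2 ^ d`. -/
theorem card_cell_le (X : Finset α) (u v : α → ℝ) (r s : ℤ) (d F : ℕ) (x₀ y₀ : ℝ)
    (h : ∀ x, (X.filter fun p => SameCell (r + d) (u p) x ∧ SameCell s (v p) y₀).card ≤ F) :
    (X.filter fun p => SameCell r (u p) x₀ ∧ SameCell s (v p) y₀).card ≤ F * 2 ^ d := by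
  set Y := X.filter fun p => SameCell r (u p) x₀ ∧ SameCell s (v p) y₀ with hY
  set c := ⌊x₀ * 2 ^ r⌋ with hc
  have himg : Y.image (fun p => ⌊u p * 2 ^ (r + d)⌋) ⊆
      Finset.Ico (c * (2 ^ d : ℕ)) ((c + 1) * (2 ^ d : ℕ)) := by
    intro t ht
    obtain ⟨p, hp, rfl⟩ := Finset.mem_image.1 ht
    have hp' := (Finset.mem_filter.1 hp).2.1
    have h2 := floor_mul_zpow_sub (u p) (r + d) d
    rw [add_sub_cancel_right, hp', ← hc] at h2
    have hpos : (0 : ℤ) < (2 ^ d : ℕ) := by positivity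
    rw [Finset.mem_Ico, ← Int.le_ediv_iff_mul_le hpos, ← Int.ediv_lt_iff_lt_mul hpos]
    omega
  have hcard : (Y.image (fun p => ⌊u p * 2 ^ (r + d)⌋)).card ≤ 2 ^ d := by
    refine (Finset.card_le_card himg).trans ?_
    rw [Int.card_Ico, ← sub_mul]
    simp
  refine (Finset.card_le_mul_card_image (f := fun p => ⌊u p * 2 ^ (r + d)⌋) Y F ?_).trans
    (Nat.mul_le_mul_left _ hcard)
  intro t ht
  obtain ⟨p, hp, rfl⟩ := Finset.mem_image.1 ht
  refine le_trans (Finset.card_le_card ?_) (h (u p))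
  intro q hq
  rw [hY, Finset.mem_filter, Finset.mem_filter] at hq
  exact Finset.mem_filter.2 ⟨hq.1.1, hq.2, hq.1.2.2⟩

/-- A `(0, 2m+1, 2)`-net in base two, with coordinate functions `u` and `v`. -/
structure IsNet (m : ℕ) (P : Finset α) (u v : α → ℝ) : Prop where
  fst_mem : ∀ p ∈ P, u p ∈ Set.Ico (0 : ℝ) 1
  snd_mem : ∀ p ∈ P, v p ∈ Set.Ico (0 : ℝ) 1
  eq_of_sameCell : ∀ p ∈ P, ∀ q ∈ P, ∀ a b : ℤ, SameCell a (u p) (u q) → SameCell b (v p) (v q) →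
    2 * m + 1 ≤ a + b → p = q
  exists_mem : ∀ a b : ℤ, 0 ≤ a → 0 ≤ b → a + b = 2 * m + 1 → ∀ x ∈ Set.Ico (0 : ℝ) 1,
    ∀ y ∈ Set.Ico (0 : ℝ) 1, ∃ p ∈ P, SameCell a (u p) x ∧ SameCell b (v p) y

/-- Keeping the coordinates as arbitrary functions `u`, `v` makes this symmetry available, so later
arguments are carried out in one coordinate only. -/
theorem IsNet.swap {m : ℕ} {P : Finset α} {u v : α → ℝ} (h : IsNet m P u v) : IsNet m P v u where
  fst_mem := h.snd_mem
  snd_mem := h.fst_mem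
  eq_of_sameCell p hp q hq a b h1 h2 hab := h.eq_of_sameCell p hp q hq b a h2 h1 (by omega)
  exists_mem a b ha hb hab x hx y hy := by
    obtain ⟨p, hp, h1, h2⟩ := h.exists_mem b a hb ha (by omega) y hy x hx
    exact ⟨p, hp, h2, h1⟩

theorem floor_mem_Ico {x : ℝ} (hx : x ∈ Set.Ico (0 : ℝ) 1) (n : ℕ) :
    ⌊x * 2 ^ (n : ℤ)⌋ ∈ Finset.Ico (0 : ℤ) (2 ^ n) := by
  have h : (0 : ℝ) < 2 ^ n := by positivity
  rw [Finset.mem_Ico, Int.floor_lt, zpow_natCast]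
  refine ⟨Int.floor_nonneg.2 (mul_nonneg hx.1 h.le), ?_⟩
  push_cast
  nlinarith [hx.2]

/-- Pigeonhole: for a fixed shape with `a + b = 2m + 1` the unit square has `2 ^ (2m+1)` cells,
separation makes the map from points to cells injective, and the cardinality makes it onto. -/
theorem IsNet.of_card {m : ℕ} {P : Finset α} {u v : α → ℝ}
    (hu : ∀ p ∈ P, u p ∈ Set.Ico (0 : ℝ) 1) (hv : ∀ p ∈ P, v p ∈ Set.Ico (0 : ℝ) 1)
    (hsep : ∀ p ∈ P, ∀ q ∈ P, ∀ a b : ℤ, SameCell a (u p) (u q) → SameCell b (v p) (v q) →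
      2 * m + 1 ≤ a + b → p = q) (hcard : P.card = 2 ^ (2 * m + 1)) : IsNet m P u v where
  fst_mem := hu
  snd_mem := hv
  eq_of_sameCell := hsep
  exists_mem := by
    classical
    intro a b ha hb hab x hx y hy
    lift a to ℕ using ha
    lift b to ℕ using hb
    set f : α → ℤ × ℤ := fun p => (⌊u p * 2 ^ (a : ℤ)⌋, ⌊v p * 2 ^ (b : ℤ)⌋) with hf
    have hsub : P.image f ⊆ Finset.Ico (0 : ℤ) (2 ^ a) ×ˢ Finset.Ico (0 : ℤ) (2 ^ b) := by
      intro t ht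
      obtain ⟨p, hp, rfl⟩ := Finset.mem_image.1 ht
      exact Finset.mem_product.2 ⟨floor_mem_Ico (hu p hp) a, floor_mem_Ico (hv p hp) b⟩
    have hinj : Set.InjOn f P := by
      intro p hp q hq hpq
      rw [hf, Prod.mk.injEq] at hpq
      exact hsep p hp q hq a b hpq.1 hpq.2 (by omega)
    have heq := Finset.eq_of_subset_of_card_le hsub (by
      rw [Finset.card_image_of_injOn hinj, hcard, Finset.card_product, Int.card_Ico, Int.card_Ico]
      have h2 : ∀ n : ℕ, ((2 : ℤ) ^ n - 0).toNat = 2 ^ n := fun n => by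
        rw [sub_zero]; exact_mod_cast Int.toNat_natCast (2 ^ n)
      rw [h2, h2, ← pow_add]
      exact le_of_eq (by congr 1; omega))
    have hmem : (⌊x * 2 ^ (a : ℤ)⌋, ⌊y * 2 ^ (b : ℤ)⌋) ∈ P.image f := by
      rw [heq]
      exact Finset.mem_product.2 ⟨floor_mem_Ico hx a, floor_mem_Ico hy b⟩
    obtain ⟨p, hp, hpe⟩ := Finset.mem_image.1 hmem
    rw [hf, Prod.mk.injEq] at hpe
    exact ⟨p, hp, hpe.1, hpe.2⟩

end Counting

theorem IsPSet.isNet {m : ℕ} {P : Finset (ℝ × ℝ)} (h : IsPSet m P) :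
    IsNet m P Prod.fst Prod.snd := by
  refine IsNet.of_card (fun p hp => (h.mem_unitSquare p hp).1)
    (fun p hp => (h.mem_unitSquare p hp).2) ?_ h.card_eq
  intro p hp q hq a b h1 h2 hab
  by_contra hne
  have h3 := h.separated p hp q hq hne
  have h4 := distH_sq_le_of_sameCell h1 h2
  have h5 : ((1 / 2 : ℝ) ^ m) ^ 2 ≤ distH p q ^ 2 := by gcongr
  rw [← pow_mul, half_pow_eq] at h5
  have h6 := (zpow_le_zpow_iff_right₀ (one_lt_two (α := ℝ))).1 (h5.trans h4)
  push_cast at h6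
  omega

/-! ### Existence of `P`-sets: Hammersley points -/

/-- One step of the recursion for the Hammersley point set. -/
noncomputable def hammersleyStep (n : ℕ) (w : (ℝ × ℝ) × ℕ) : ℝ × ℝ :=
  ((w.1.1 + w.2) / 2, w.1.2 + w.2 / 2 ^ (n + 1))

/-- The step by `e ∈ {0, 1}` prepends the digit `e` to the first coordinate and appends it to the
second. Integrality of `p.2 * 2 ^ n` is carried through the induction so that the appended digit
leaves all cells of level at most `n` unchanged. -/
theorem exists_hammersley (n : ℕ) : ∃ P : Finset (ℝ × ℝ),
    (∀ p ∈ P, p ∈ unitSquare) ∧ (∀ p ∈ P, ∃ t : ℤ, p.2 * 2 ^ n = t) ∧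
    (∀ p ∈ P, ∀ q ∈ P, ∀ a b : ℤ, SameCell a p.1 q.1 → SameCell b p.2 q.2 → n ≤ a + b → p = q) ∧
    P.card = 2 ^ n := by
  classical
  induction n with
  | zero =>
    refine ⟨{(0, 0)}, ?_, ?_, ?_, by simp⟩
    · simp [unitSquare]
    · simp
      exact ⟨0, by simp⟩
    · intro p hp q hq _ _ _ _ _
      rw [Finset.mem_singleton.1 hp, Finset.mem_singleton.1 hq]
  | succ n ih =>
    obtain ⟨P, hU, hint, hsep, hcard⟩ := ih
    have hpow : (0 : ℝ) < 2 ^ n := by positivity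
    have he : ∀ w ∈ P ×ˢ Finset.range 2, (w.2 : ℝ) = 0 ∨ (w.2 : ℝ) = 1 := by
      intro w hw
      have := Finset.mem_range.1 (Finset.mem_product.1 hw).2
      interval_cases w.2 <;> simp
    have hsnd : ∀ w ∈ P ×ˢ Finset.range 2, ∀ t : ℤ, w.1.2 * 2 ^ n = t →
        (hammersleyStep n w).2 * 2 ^ (n + 1) = (2 * t + w.2 : ℤ) := by
      intro w hw t ht
      simp only [hammersleyStep]
      push_cast
      rw [← ht, add_mul, div_mul_cancel₀ _ (by positivity)]
      ring
    have hsame : ∀ w ∈ P ×ˢ Finset.range 2, SameCell n (hammersleyStep n w).2 w.1.2 := by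
      intro w hw
      obtain ⟨t, ht⟩ := hint w.1 (Finset.mem_product.1 hw).1
      unfold SameCell
      rw [zpow_natCast, ht, Int.floor_intCast, Int.floor_eq_iff]
      have := hsnd w hw t ht
      rw [pow_succ] at this
      push_cast at this
      rcases he w hw with h | h <;> rw [h] at this <;> constructor <;> linarith
    have hfst : ∀ w ∈ P ×ˢ Finset.range 2, ∀ a : ℤ, 1 ≤ a →
        ⌊(hammersleyStep n w).1 * 2 ^ a⌋ = ⌊w.1.1 * 2 ^ (a - 1)⌋ + w.2 * 2 ^ (a - 1).toNat := by
      intro w hw a ha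
      obtain ⟨d, hd⟩ := Int.eq_ofNat_of_zero_le (sub_nonneg.2 ha)
      obtain rfl : a = d + 1 := by omega
      rw [add_sub_cancel_right, Int.toNat_natCast, zpow_add₀ two_ne_zero, zpow_natCast, zpow_one,
        ← Int.floor_add_intCast]
      congr 1
      simp only [hammersleyStep]
      push_cast
      ring
    have hkey : ∀ w ∈ P ×ˢ Finset.range 2, ∀ w' ∈ P ×ˢ Finset.range 2, ∀ a b : ℤ,
        SameCell a (hammersleyStep n w).1 (hammersleyStep n w').1 →
        SameCell b (hammersleyStep n w).2 (hammersleyStep n w').2 →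
        ((n + 1 : ℕ) : ℤ) ≤ a + b → w = w' := by
      intro w hw w' hw' a b h1 h2 hab
      have hwP := (Finset.mem_product.1 hw).1
      have hwP' := (Finset.mem_product.1 hw').1
      have hfin : w.1 = w'.1 → w.2 = w'.2 → w = w' := fun h h' => Prod.ext h h'
      -- At level `n + 1` the second coordinate is known completely, hence so are `e` and the old
      -- point. Otherwise `a ≥ 1`, the leading digit of the first coordinate reveals `e`, and
      -- removing it lowers the level by one.
      by_cases hb : (n : ℤ) + 1 ≤ b
      · obtain ⟨t, ht⟩ := hint w.1 hwP
        obtain ⟨t', ht'⟩ := hint w'.1 hwP'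
        have h3 := h2.mono hb
        unfold SameCell at h3
        rw [← Nat.cast_succ, zpow_natCast, hsnd w hw t ht, hsnd w' hw' t' ht', Int.floor_intCast,
          Int.floor_intCast] at h3
        have e1 := Finset.mem_range.1 (Finset.mem_product.1 hw).2
        have e2 := Finset.mem_range.1 (Finset.mem_product.1 hw').2
        have htt : t = t' := by omega
        refine hfin ?_ (by omega)
        refine hsep _ hwP _ hwP' 0 n
          (sameCell_of_mem_Ico (hU _ hwP).1 (hU _ hwP').1 le_rfl) ?_ (by omega)
        unfold SameCell
        rw [zpow_natCast, ht, ht', htt]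
      · have ha : 1 ≤ a := by push_cast at hab; omega
        have hee : w.2 = w'.2 := by
          have h3 := h1.mono ha
          unfold SameCell at h3
          rw [hfst w hw 1 le_rfl, hfst w' hw' 1 le_rfl] at h3
          simp only [sub_self, zpow_zero, mul_one, Int.toNat_zero, pow_zero] at h3
          rw [Int.floor_eq_zero_iff.2 (hU _ hwP).1, Int.floor_eq_zero_iff.2 (hU _ hwP').1] at h3
          omega
        refine hfin ?_ hee
        refine hsep _ hwP _ hwP' (a - 1) b ?_ ?_ (by push_cast at hab; omega)
        · unfold SameCell at h1 ⊢
          rw [hfst w hw a ha, hfst w' hw' a ha, hee] at h1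
          omega
        · have hbn : b ≤ n := by omega
          exact ((hsame w hw).mono hbn).symm.trans (h2.trans ((hsame w' hw').mono hbn))
    refine ⟨(P ×ˢ Finset.range 2).image (hammersleyStep n), ?_, ?_, ?_, ?_⟩
    · intro p hp
      obtain ⟨w, hw, rfl⟩ := Finset.mem_image.1 hp
      have hwU := hU _ (Finset.mem_product.1 hw).1
      refine ⟨?_, (hsame w hw).mem_Ico (by omega) hwU.2⟩
      have h1 := hwU.1.1
      have h2 := hwU.1.2
      simp only [hammersleyStep]
      rcases he w hw with h | h <;> rw [h] <;> constructor <;> linarith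
    · intro p hp
      obtain ⟨w, hw, rfl⟩ := Finset.mem_image.1 hp
      obtain ⟨t, ht⟩ := hint w.1 (Finset.mem_product.1 hw).1
      exact ⟨_, hsnd w hw t ht⟩
    · intro p hp q hq a b h1 h2 hab
      obtain ⟨w, hw, rfl⟩ := Finset.mem_image.1 hp
      obtain ⟨w', hw', rfl⟩ := Finset.mem_image.1 hq
      rw [hkey w hw w' hw' a b h1 h2 hab]
    · rw [Finset.card_image_of_injOn, Finset.card_product, hcard, Finset.card_range, pow_succ]
      intro w hw w' hw' h
      refine hkey w hw w' hw' (n + 1 : ℕ) 0 ?_ ?_ (by omega) <;> rw [h] <;> exact .refl _ _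

theorem exists_isPSet (m : ℕ) : ∃ P : Finset (ℝ × ℝ), IsPSet m P := by
  obtain ⟨P, hU, -, hsep, hcard⟩ := exists_hammersley (2 * m + 1)
  refine ⟨P, hU, ?_, hcard⟩
  intro p hp q hq hne
  have h : (2 : ℝ) ^ (-(2 * m : ℤ)) ≤ distH p q ^ 2 := by
    refine le_distH_sq (hU p hp) (hU q hq) fun a b h1 h2 => ?_
    by_contra! hlt
    exact hne (hsep p hp q hq a b h1 h2 (by push_cast; omega))
  rw [← pow_le_pow_iff_left₀ (by positivity) (distH_nonneg p q) two_ne_zero, ← pow_mul,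
    half_pow_eq, mul_comm m 2]
  exact_mod_cast h

/-! ### Companion points of a net -/

section Companion

variable {α : Type*} {m : ℕ} {P : Finset α} {u v : α → ℝ}

/-- A coordinate next to `u p` that keeps away from the other points of the net. -/
theorem IsNet.exists_coordinate_aux (h : IsNet m P u v) {p : α} (hp : p ∈ P) {i : ℤ}
    (hi : 0 ≤ i) (t : ℕ) (ht : i + t ≤ 2 * m + 1) :
    ∃ x, SameCell i x (u p) ∧ ¬ SameCell (i + 1) x (u p) ∧
      ∀ l : ℤ, i < l → l ≤ i + t + 1 → ∀ q ∈ P, SameCell l (u q) x →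
        ¬ SameCell (2 * m + 2 - l) (v q) (v p) := by
  induction t with
  | zero =>
    obtain ⟨x, hx, hx'⟩ := exists_sibling (u p) i
    refine ⟨x, hx, hx', fun l hl hl' q hq hqx hqp => ?_⟩
    obtain rfl : l = i + 1 := by push_cast at hl'; omega
    have := h.eq_of_sameCell q hq p hp i (2 * m + 1 - i) ((hqx.mono (by omega)).trans hx)
      (hqp.mono (by omega)) (by omega)
    subst this
    exact hx' hqx.symm
  | succ t ih =>
    push_cast at ht
    obtain ⟨x, hx, hx', hav⟩ := ih (by omega)
    -- At each level the rectangle of area `2 ^ (-(2m+1))` around `(x, v p)` holds a single net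
    -- point `q₀`. Moving `x` into the half that misses `q₀` empties the next rectangle, of area `2
    -- ^ (-(2m+2))`, without changing the earlier levels.
    have hxI := hx.mem_Ico hi (h.fst_mem p hp)
    obtain ⟨q₀, hq₀, h1, h2⟩ := h.exists_mem (i + t + 1) (2 * m + 1 - (i + t + 1)) (by omega)
      (by omega) (by omega) x hxI (v p) (h.snd_mem p hp)
    obtain ⟨y, hy, hy'⟩ := exists_avoid x (u q₀) (i + t + 1)
    refine ⟨y, (hy.mono (by omega)).trans hx,
      fun hc => hx' ((hy.mono (by omega)).symm.trans hc), fun l hl hl' q hq hqy hqp => ?_⟩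
    by_cases hlt : l ≤ i + t + 1
    · exact hav l hl hlt q hq (hqy.trans (hy.mono hlt)) hqp
    · obtain rfl : l = i + t + 1 + 1 := by push_cast at hl'; omega
      have := h.eq_of_sameCell q hq q₀ hq₀ (i + t + 1) (2 * m + 1 - (i + t + 1))
        (((hqy.mono (by omega)).trans hy).trans h1.symm)
        ((hqp.mono (by omega)).trans h2.symm) (by omega)
      subst this
      exact hy' hqy.symm

theorem IsNet.exists_coordinate (h : IsNet m P u v) {p : α} (hp : p ∈ P) {i : ℤ}
    (hi : 0 ≤ i) (hi' : i ≤ 2 * m + 1) :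
    ∃ x ∈ Set.Ico (0 : ℝ) 1, SameCell i x (u p) ∧ ¬ SameCell (i + 1) x (u p) ∧
      ∀ q ∈ P, ∀ a b : ℤ, i < a → SameCell a (u q) x → SameCell b (v q) (v p) →
        a + b ≤ 2 * m + 1 := by
  obtain ⟨t, ht⟩ := Int.eq_ofNat_of_zero_le (sub_nonneg.2 hi')
  obtain ⟨x, hx, hx', hav⟩ := h.exists_coordinate_aux hp hi t (by omega)
  refine ⟨x, hx.mem_Ico hi (h.fst_mem p hp), hx, hx', fun q hq a b ha hqa hqb => ?_⟩
  by_contra! hlt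
  -- Larger `a + b` reduces to `a + b = 2m + 2` by enlarging cells. Beyond level `2m + 2` the
  -- condition on the second coordinate becomes membership in the unit interval.
  by_cases hal : a ≤ 2 * m + 2
  · exact hav a ha (by omega) q hq hqa (hqb.mono (by omega))
  · refine hav (2 * m + 2) (by omega) (by omega) q hq (hqa.mono (by omega)) ?_
    exact sameCell_of_mem_Ico (h.snd_mem q hq) (h.snd_mem p hp) (by omega)

/-- `z` parts from `p` exactly at the levels `i` and `j` and is far from the rest of `P`. -/
structure IsCompanion (m : ℕ) (P : Finset α) (u v : α → ℝ) (p : α) (i j : ℤ) (z : ℝ × ℝ) :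
    Prop where
  fst_same : SameCell i z.1 (u p)
  fst_split : ¬ SameCell (i + 1) z.1 (u p)
  snd_same : SameCell j z.2 (v p)
  snd_split : ¬ SameCell (j + 1) z.2 (v p)
  eq_of_near : ∀ q ∈ P, ∀ a b : ℤ, SameCell a z.1 (u q) → SameCell b z.2 (v q) →
    2 * m + 2 ≤ a + b → q = p

theorem IsCompanion.swap {p : α} {i j : ℤ} {z : ℝ × ℝ} (h : IsCompanion m P u v p i j z) :
    IsCompanion m P v u p j i z.swap where
  fst_same := h.snd_same
  fst_split := h.snd_split
  snd_same := h.fst_same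
  snd_split := h.fst_split
  eq_of_near q hq a b h1 h2 hab := h.eq_of_near q hq b a h2 h1 (by omega)

theorem IsNet.exists_companion (h : IsNet m P u v) {p : α} (hp : p ∈ P) {i j : ℤ}
    (hi : 0 ≤ i) (hi' : i ≤ 2 * m + 1) (hj : 0 ≤ j) (hj' : j ≤ 2 * m + 1)
    (hij : 2 * m + 1 ≤ i + j) : ∃ z ∈ unitSquare, IsCompanion m P u v p i j z := by
  obtain ⟨x, hxI, hx, hx', hxa⟩ := h.exists_coordinate hp hi hi'
  obtain ⟨y, hyI, hy, hy', hya⟩ := h.swap.exists_coordinate hp hj hj'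
  refine ⟨(x, y), ⟨hxI, hyI⟩, hx, hx', hy, hy', fun q hq a b h1 h2 hab => ?_⟩
  by_contra hne
  -- If both levels are coarse, or both are fine, then `q` and `p` share a cell of area at most `2 ^
  -- (-(2m+1))`. In the mixed cases the avoidance property of `x` or of `y` applies.
  by_cases ha : a ≤ i
  · by_cases hb : b ≤ j
    · exact hne (h.eq_of_sameCell q hq p hp a b (h1.symm.trans (hx.mono ha))
        (h2.symm.trans (hy.mono hb)) (by omega))
    · have := hya q hq b a (by omega) h2.symm (h1.symm.trans (hx.mono ha))
      omega
  · by_cases hb : b ≤ j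
    · have := hxa q hq a b (by omega) h1.symm (h2.symm.trans (hy.mono hb))
      omega
    · exact hne (h.eq_of_sameCell q hq p hp i j
        ((h1.mono (by omega)).symm.trans hx) ((h2.mono (by omega)).symm.trans hy) hij)

/-- A net point `q` this close to `z` must be `p`. Then `z` has not yet left the `w`-cell of `p`, so
`w ≤ i` and `p'` lies in the same `(w, d)` cell as `p`. -/
theorem IsNet.companion_cell_aux (h : IsNet m P u v) {p p' : α} (hp : p ∈ P) (hp' : p' ∈ P)
    {i j d w : ℤ} {z z' : ℝ × ℝ} (hz : IsCompanion m P u v p i j z)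
    (hz' : IsCompanion m P u v p' i j z') (hd : d < j) (hwd : w + d = 2 * m + 1)
    (h1 : SameCell w z.1 z'.1) (h2 : SameCell d z.2 z'.2) {q : α} (hq : q ∈ P)
    (hqw : SameCell w (u q) z.1) (hqd : SameCell (d + 1) (v q) z.2) : p = p' := by
  have hqp := hz.eq_of_near q hq w (d + 1) hqw.symm hqd.symm (by omega)
  subst hqp
  have hwi : w ≤ i := hqw.symm.le_of_split hz.fst_split
  exact h.eq_of_sameCell q hp p' hp' w d
    (hqw.trans (h1.trans (hz'.fst_same.mono hwi)))
    ((hqd.mono (by omega)).trans (h2.trans (hz'.snd_same.mono hd.le))) (by omega)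

/-- If `z` and `z'` share the second cell up to level `j`, so do `p` and `p'`. Otherwise they part
at some level `d < j`. The net point in their common cell of levels `2m + 1 - d` and `d` lies in the
vertical half of `z` or in that of `z'`, and `companion_cell_aux` applies to that one. -/
theorem IsNet.companion_cell_of_lt (h : IsNet m P u v) {p p' : α} (hp : p ∈ P) (hp' : p' ∈ P)
    {i j r s : ℤ} {z z' : ℝ × ℝ} (hzU : z ∈ unitSquare) (hzU' : z' ∈ unitSquare)
    (hz : IsCompanion m P u v p i j z)
    (hz' : IsCompanion m P u v p' i j z') (hij : 2 * m + 1 ≤ i + j) (hj : j ≤ 2 * m + 2)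
    (hrs : r + s = 2 * m + 2) (hir : i < r)
    (h1 : SameCell r z.1 z'.1) (h2 : SameCell s z.2 z'.2) : p = p' := by
  by_cases hjz : SameCell j z.2 z'.2
  · exact h.eq_of_sameCell p hp p' hp' i j
      (hz.fst_same.symm.trans ((h1.mono hir.le).trans hz'.fst_same))
      (hz.snd_same.symm.trans (hjz.trans hz'.snd_same)) hij
  · have hne : z.2 ≠ z'.2 := fun he => hjz (he ▸ .refl _ _)
    have h3 : SameCell (max s 0) z.2 z'.2 := by
      rcases max_cases s 0 with ⟨he, -⟩ | ⟨he, -⟩ <;> rw [he]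
      · exact h2
      · exact sameCell_of_mem_Ico hzU.2 hzU'.2 le_rfl
    obtain ⟨d, hsd, hd, hd'⟩ := exists_split hne h3
    have hdj : d < j := by
      by_contra! hle
      exact hjz (hd.mono hle)
    have h4 := le_max_left s 0
    have h5 := le_max_right s 0
    have hw : SameCell (2 * m + 1 - d) z.1 z'.1 := h1.mono (by omega)
    obtain ⟨q, hq, hq1, hq2⟩ := h.exists_mem (2 * m + 1 - d) d (by omega) (by omega) (by omega)
      z.1 hzU.1 z.2 hzU.2
    rcases hd.halves hq2.symm hd' with hc | hc
    · exact h.companion_cell_aux hp hp' hz hz' hdj (by omega) hw hd hq hq1 hc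
    · exact (h.companion_cell_aux hp' hp hz' hz hdj (by omega) hw.symm hd.symm hq
        (hq1.trans hw) hc).symm

/-- Companions of the same shape in a common cell of area `2 ^ (-2m-2)` belong to the same
point of the net. -/
theorem IsNet.companion_cell (h : IsNet m P u v) {p p' : α} (hp : p ∈ P) (hp' : p' ∈ P)
    {i j r s : ℤ} {z z' : ℝ × ℝ} (hzU : z ∈ unitSquare) (hzU' : z' ∈ unitSquare)
    (hz : IsCompanion m P u v p i j z)
    (hz' : IsCompanion m P u v p' i j z') (hij : 2 * m + 1 ≤ i + j) (hi : i ≤ 2 * m + 2)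
    (hj : j ≤ 2 * m + 2) (hrs : r + s = 2 * m + 2)
    (h1 : SameCell r z.1 z'.1) (h2 : SameCell s z.2 z'.2) : p = p' := by
  by_cases hir : i < r
  · exact h.companion_cell_of_lt hp hp' hzU hzU' hz hz' hij hj hrs hir h1 h2
  by_cases hjs : j < s
  · exact h.swap.companion_cell_of_lt hp hp' (z := z.swap) (z' := z'.swap) ⟨hzU.2, hzU.1⟩
      ⟨hzU'.2, hzU'.1⟩ hz.swap hz'.swap (by omega) hi (r := s) (s := r) (by omega) hjs h2 h1
  · exact h.eq_of_sameCell p hp p' hp' r s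
      ((hz.fst_same.mono (by omega)).symm.trans (h1.trans (hz'.fst_same.mono (by omega))))
      ((hz.snd_same.mono (by omega)).symm.trans (h2.trans (hz'.snd_same.mono (by omega))))
      (by omega)

end Companion

/-! ### Construction of `Z`-sets -/

open Classical in
theorem ncard_inter_toSet (Z : Finset (ℝ × ℝ)) (R : DyadicRectangle) {x : ℝ × ℝ}
    (hx : x ∈ R.toSet) : ((Z : Set (ℝ × ℝ)) ∩ R.toSet).ncard =
      (Z.filter fun z => SameCell (-R.fst.scale) z.1 x.1 ∧
        SameCell (-R.snd.scale) z.2 x.2).card := by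
  rw [← Set.ncard_coe_finset]
  congr 1
  ext z
  simp only [Set.mem_inter_iff, Finset.mem_coe, Finset.coe_filter, Set.mem_ofPred_eq]
  refine and_congr_right fun _ => ⟨fun hz => DyadicRectangle.sameCell_of_mem hz hx, fun hz => ?_⟩
  exact ⟨DyadicInterval.mem_of_sameCell hz.1 hx.1, DyadicInterval.mem_of_sameCell hz.2 hx.2⟩

theorem exists_isZSet_of_isPSet {k m : ℕ} (hk : 1 ≤ k) (hkm : k ≤ m) {P : Finset (ℝ × ℝ)}
    (hP : IsPSet m P) : ∃ Z : Finset (ℝ × ℝ), IsZSet 8 k m P Z := by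
  classical
  have hN := hP.isNet
  -- The shapes `(i, J i)` all have level sum `2m + k + 1`. The range `k ≤ i ≤ 2m` keeps both
  -- entries at most `2m + 1`, as `exists_companion` requires.
  set J : ℕ → ℤ := fun i => 2 * m + k + 1 - i with hJ
  set T := P ×ˢ Finset.Icc k (2 * m) with hT
  have hex : ∀ w : (ℝ × ℝ) × ℕ, w ∈ T → ∃ z ∈ unitSquare,
      IsCompanion m P Prod.fst Prod.snd w.1 w.2 (J w.2) z := by
    intro w hw
    obtain ⟨hw1, hw2⟩ := Finset.mem_product.1 hw
    rw [Finset.mem_Icc] at hw2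
    exact hN.exists_companion hw1 (by omega) (by omega) (by simp only [hJ]; omega)
      (by simp only [hJ]; omega) (by simp only [hJ]; omega)
  choose! ζ hζU hζ using hex
  have hJw : ∀ w : (ℝ × ℝ) × ℕ, (w.2 : ℤ) + J w.2 = 2 * m + k + 1 := fun w => by
    simp only [hJ]; omega
  have hinj : Set.InjOn ζ T := by
    intro w hw w' hw' he
    have c := hζ w hw
    have c' := hζ w' hw'
    have hp : w.1 = w'.1 := c'.eq_of_near w.1 (Finset.mem_product.1 hw).1 w.2 (J w.2)
      (he ▸ c.fst_same) (he ▸ c.snd_same) (by rw [hJw]; omega)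
    have h1 : (w.2 : ℤ) ≤ w'.2 := SameCell.le_of_split
      (x := (ζ w').1) (y := w'.1.1) (by rw [← he, ← hp]; exact c.fst_same) c'.fst_split
    have h2 : (w'.2 : ℤ) ≤ w.2 := SameCell.le_of_split
      (x := (ζ w).1) (y := w.1.1) (by rw [he, hp]; exact c'.fst_same) c.fst_split
    exact Prod.ext hp (by omega)
  have hmemZ : ∀ z ∈ T.image ζ, ∃ w ∈ T, ζ w = z := fun z hz => by
    simpa using Finset.mem_image.1 hz
  have hdist : ∀ w ∈ T, distH w.1 (ζ w) ^ 2 = 2 ^ (-(2 * m + k + 1 : ℤ)) := by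
    intro w hw
    have c := hζ w hw
    apply le_antisymm
    · rw [← hJw w]
      exact distH_sq_le_of_sameCell c.fst_same.symm c.snd_same.symm
    · refine le_distH_sq (hP.mem_unitSquare _ (Finset.mem_product.1 hw).1) (hζU w hw)
        fun a b h1 h2 => ?_
      have := h1.symm.le_of_split c.fst_split
      have := h2.symm.le_of_split c.snd_split
      have := hJw w
      omega
  have hnear : ∀ w ∈ T, ∀ p ∈ P, distH p (ζ w) ^ 2 < (1 / 2 : ℝ) ^ (2 * m + 1) → p = w.1 := by
    intro w hw p hp hlt
    rw [half_pow_eq] at hlt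
    obtain ⟨a, b, h1, h2, hab⟩ := exists_sameCell_of_distH_sq_lt (hP.mem_unitSquare p hp)
      (hζU w hw) hlt
    exact (hζ w hw).eq_of_near p hp a b h1.symm h2.symm (by push_cast at hab; omega)
  -- Each shape occurs at most once in such a cell, by `companion_cell`, and there are at most `2m`
  -- shapes.
  have hfib : ∀ r s : ℤ, r + s = 2 * m + 2 → ∀ x y : ℝ,
      ((T.image ζ).filter fun z => SameCell r z.1 x ∧ SameCell s z.2 y).card ≤ 2 * m := by
    intro r s hrs x y
    rw [Finset.filter_image]
    refine Finset.card_image_le.trans ?_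
    refine (Finset.card_le_card_of_injOn (t := Finset.Icc k (2 * m)) Prod.snd ?_ ?_).trans ?_
    · intro w hw
      exact (Finset.mem_product.1 (Finset.mem_filter.1 hw).1).2
    · intro w hw w' hw' he
      obtain ⟨hwT, h1, h2⟩ := Finset.mem_filter.1 hw
      obtain ⟨hwT', h1', h2'⟩ := Finset.mem_filter.1 hw'
      obtain ⟨hp, hi⟩ := Finset.mem_product.1 hwT
      rw [Finset.mem_Icc] at hi
      have := hJw w
      refine Prod.ext ?_ he
      refine hN.companion_cell hp (Finset.mem_product.1 hwT').1
        (hζU w hwT) (hζU w' hwT') (hζ w hwT) (i := w.2) (j := J w.2) ?_ (by omega) (by omega)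
        (by omega) hrs (h1.trans h1'.symm) (h2.trans h2'.symm)
      have he' : w.2 = w'.2 := he
      rw [he']
      exact hζ w' hwT'
    · rw [Nat.card_Icc]; omega
  have hZcard : (T.image ζ).card = 2 ^ (2 * m + 1) * (2 * m + 1 - k) := by
    rw [Finset.card_image_of_injOn hinj, hT, Finset.card_product, hP.card_eq, Nat.card_Icc]
  refine ⟨T.image ζ, ?_, ?_, ?_, ?_, ?_, ?_⟩
  · intro z hz
    obtain ⟨w, hw, rfl⟩ := hmemZ z hz
    exact hζU w hw
  · have h1 : m * 2 ^ (2 * m) ≤ 8 * (T.image ζ).card := by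
      rw [hZcard, pow_succ]
      have : m ≤ 2 * m + 1 - k := by omega
      calc m * 2 ^ (2 * m) = 2 ^ (2 * m) * m := mul_comm _ _
        _ ≤ 2 ^ (2 * m) * (2 * m + 1 - k) := by gcongr
        _ ≤ 16 * (2 ^ (2 * m) * (2 * m + 1 - k)) := by omega
        _ = _ := by ring
    exact_mod_cast h1
  · intro z hz
    obtain ⟨w, hw, rfl⟩ := hmemZ z hz
    refine ⟨w.1, ⟨(Finset.mem_product.1 hw).1, ?_⟩, fun p hp => hnear w hw p hp.1 hp.2⟩
    rw [hdist w hw, half_pow_eq]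
    exact zpow_lt_zpow_right₀ one_lt_two (by push_cast; omega)
  · intro z hz p hp hlt
    obtain ⟨w, hw, rfl⟩ := hmemZ z hz
    obtain rfl := hnear w hw p hp hlt
    have h2 : (2 : ℝ) ^ (-(2 * m + k + 1 : ℤ)) = (1 / 2) ^ (2 * m + k) / 2 := by
      rw [show -(2 * m + k + 1 : ℤ) = -((2 * m + k : ℕ) : ℤ) - 1 by push_cast; ring,
        zpow_sub₀ two_ne_zero, ← half_pow_eq, zpow_one]
    have h3 : (0 : ℝ) < (1 / 2) ^ (2 * m + k) := by positivity
    rw [hdist w hw, h2]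
    constructor <;> linarith
  · rintro R hR ⟨p, hp, hpR⟩
    rw [ncard_inter_toSet _ R hpR]
    have hR' : 2 * m + 2 ≤ -R.fst.scale + -R.snd.scale := by
      rw [R.area_eq, half_pow_eq, zpow_le_zpow_iff_right₀ (one_lt_two (α := ℝ))] at hR
      push_cast at hR
      omega
    set r := -R.fst.scale
    set s := -R.snd.scale
    -- Every `z` counted here is a companion of `p` with `i ≥ r` and `J i ≥ s`. As `r + s ≥ 2m + 2`,
    -- this leaves at most `k` values of `i`.
    have : ((T.image ζ).filter fun z => SameCell r z.1 p.1 ∧ SameCell s z.2 p.2).card ≤ k := by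
      rw [Finset.filter_image]
      refine Finset.card_image_le.trans ?_
      refine (Finset.card_le_card_of_injOn (t := Finset.Icc r (2 * m + k + 1 - s))
        (fun w => (w.2 : ℤ)) ?_ ?_).trans ?_
      · intro w hw
        obtain ⟨hwT, h1, h2⟩ := Finset.mem_filter.1 hw
        have hpw := (hζ w hwT).eq_of_near p hp r s h1 h2 hR'
        subst hpw
        have := h1.le_of_split (hζ w hwT).fst_split
        have := h2.le_of_split (hζ w hwT).snd_split
        have := hJw w
        simp only [Finset.coe_Icc, Set.mem_Icc]
        omega
      · intro w hw w' hw' he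
        obtain ⟨hwT, h1, h2⟩ := Finset.mem_filter.1 hw
        obtain ⟨hwT', h1', h2'⟩ := Finset.mem_filter.1 hw'
        have he' : (w.2 : ℤ) = w'.2 := he
        refine Prod.ext ?_ (by omega)
        rw [← (hζ w hwT).eq_of_near p hp r s h1 h2 hR',
          ← (hζ w' hwT').eq_of_near p hp r s h1' h2' hR']
      · rw [Int.card_Icc]; omega
    have h4 : (((T.image ζ).filter fun z => SameCell r z.1 p.1 ∧ SameCell s z.2 p.2).card : ℝ)
      ≤ k := by exact_mod_cast this
    have : (0 : ℝ) ≤ k := by positivity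
    linarith
  · intro R hR
    by_cases hne : R.toSet.Nonempty
    swap
    · rw [Set.not_nonempty_iff_eq_empty.1 hne, Set.inter_empty, Set.ncard_empty]
      have := R.area_pos
      push_cast; positivity
    obtain ⟨x, hx⟩ := hne
    rw [ncard_inter_toSet _ R hx]
    rw [R.area_eq] at hR ⊢
    have hR' : -R.fst.scale + -R.snd.scale ≤ 2 * m + 1 := by
      rw [half_pow_eq, zpow_le_zpow_iff_right₀ (one_lt_two (α := ℝ))] at hR
      push_cast at hR
      omega
    set r := -R.fst.scale
    set s := -R.snd.scale
    -- The rectangle is cut into `2 ^ d` cells of area `2 ^ (-(2m+2))`. The bound `2m` per cell and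
    -- the factor `4` in `2 ^ d` produce the constant `8`.
    obtain ⟨d, hd⟩ := Int.eq_ofNat_of_zero_le (show 0 ≤ 2 * m + 2 - s - r by omega)
    have hle := card_cell_le (T.image ζ) Prod.fst Prod.snd r s d (2 * m) x.1 x.2
      fun y => hfib (r + d) s (by omega) y x.2
    have hle' : (((T.image ζ).filter fun z => SameCell r z.1 x.1 ∧ SameCell s z.2 x.2).card : ℝ)
      ≤ 2 * m * 2 ^ d := by exact_mod_cast hle
    refine hle'.trans ?_
    have h5 : (2 : ℝ) ^ d = 4 * (2 ^ (2 * m) * 2 ^ (-(r + s))) := by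
      rw [← zpow_natCast, ← zpow_natCast (2 : ℝ) (2 * m), ← zpow_add₀ two_ne_zero,
        show (d : ℤ) = 2 + ((2 * m : ℕ) + -(r + s)) by push_cast; omega, zpow_add₀ two_ne_zero 2]
      norm_num
    rw [h5]
    have hk' : (1 : ℝ) ≤ k := by exact_mod_cast hk
    have h6 : (0 : ℝ) ≤ m * (2 ^ (2 * m) * 2 ^ (-(r + s))) := by positivity
    nlinarith

/-! ### Lower bound for the martingale transform -/

theorem DyadicInterval.haar_around_mul {a a' : ℤ} {p z : ℝ} (h : SameCell a' z p)
    (h' : ¬ SameCell (a' + 1) z p) :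
    (around a p).haar p * (around a p).haar z =
      if a < a' then 2 ^ a else if a = a' then -2 ^ a else 0 := by
  have hp : p ∈ (around a p).toSet := mem_around.2 (.refl _ _)
  have hs : -(around a p).scale = a := by simp [around]
  split_ifs with h1 h2
  · rw [haar_congr (y := p) (x := z) (by rw [hs]; exact h.mono (by omega)), haar_mul_self hp, hs]
  · subst h2
    rw [haar_mul_of_split hp (mem_around.2 h) (by rw [hs]; exact fun hc => h' hc.symm), hs]
  · rw [haar_of_notMem (x := z), mul_zero]
    intro hz
    have := (mem_around.1 hz).le_of_split h'
    omega

theorem DyadicRectangle.haar_of_notMem {R : DyadicRectangle} {x : ℝ × ℝ} (h : x ∉ R.toSet) :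
    R.haar x = 0 := by
  rw [DyadicRectangle.haar]
  by_cases hc : x.1 ∈ R.fst.toSet
  · rw [DyadicInterval.haar_of_notMem (x := x.2) (fun hc' => h ⟨hc, hc'⟩), mul_zero]
  · rw [DyadicInterval.haar_of_notMem hc, zero_mul]

theorem integral_uniformMeasure (F : Finset (ℝ × ℝ)) (f : ℝ × ℝ → ℝ) :
    ∫ x, f x ∂(uniformMeasure F) = (F.card : ℝ)⁻¹ * ∑ p ∈ F, f p := by
  rw [uniformMeasure, integral_smul_measure, integral_finsetSum_measure]
  · simp [integral_dirac]
  · intro p _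
    exact integrable_dirac (by simp)

theorem integral_transformMeasure {σ : DyadicRectangle → ℝ} {T : Finset DyadicRectangle}
    (hσ : ∀ R ∉ T, σ R = 0) (P Z : Finset (ℝ × ℝ)) :
    ∫ z, transformMeasure σ (uniformMeasure P) z ∂(uniformMeasure Z) =
      (Z.card : ℝ)⁻¹ * ((P.card : ℝ)⁻¹ *
        ∑ z ∈ Z, ∑ p ∈ P, ∑ R ∈ T, σ R * (R.haar p * R.haar z)) := by
  rw [integral_uniformMeasure]
  congr 1
  rw [Finset.mul_sum]
  refine Finset.sum_congr rfl fun z _ => ?_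
  rw [transformMeasure, tsum_eq_sum (s := T) (fun R hR => by rw [hσ R hR]; simp),
    Finset.sum_comm, Finset.mul_sum]
  refine Finset.sum_congr rfl fun R _ => ?_
  rw [integral_uniformMeasure, Finset.mul_sum, Finset.mul_sum, Finset.mul_sum, Finset.sum_mul]
  exact Finset.sum_congr rfl fun p _ => by ring

theorem sum_four_pow_le (n : ℕ) : ∑ b ∈ Finset.range n, (4 : ℝ) ^ b ≤ 4 ^ n / 3 := by
  have := geom_sum_eq (x := (4 : ℝ)) (by norm_num) n
  rw [this]
  linarith

/-- The sum of `h_R(p) h_R(z)`, weighted by `|R|⁻¹`, is dominated by its smallest rectangle. -/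
theorem le_sum_haar {a' b' : ℕ} {p z : ℝ × ℝ} (S : Finset (ℕ × ℕ)) (hS : (a', b') ∈ S)
    (h1 : SameCell a' z.1 p.1) (h1' : ¬ SameCell (a' + 1) z.1 p.1)
    (h2 : SameCell b' z.2 p.2) (h2' : ¬ SameCell (b' + 1) z.2 p.2) :
    (4 : ℝ) ^ (a' + b') / 3 ≤ ∑ w ∈ S, (2 : ℝ) ^ (w.1 + w.2) *
      ((DyadicRectangle.around w.1 w.2 p).haar p * (DyadicRectangle.around w.1 w.2 p).haar z) := by
  classical
  -- Positive terms other than the smallest rectangle are dropped. The negative ones have exactly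
  -- one minimal side; the two families sum to at most `1/3` of the main term each, leaving `1 - 1/3
  -- - 1/3`.
  have hpt : ∀ w ∈ S, ((if w = (a', b') then (4 : ℝ) ^ (a' + b') else 0) -
      (if w.1 = a' ∧ w.2 < b' then (4 : ℝ) ^ (w.1 + w.2) else 0)) -
      (if w.2 = b' ∧ w.1 < a' then (4 : ℝ) ^ (w.1 + w.2) else 0) ≤ (2 : ℝ) ^ (w.1 + w.2) *
      ((DyadicRectangle.around w.1 w.2 p).haar p *
        (DyadicRectangle.around w.1 w.2 p).haar z) := by
    rintro ⟨a, b⟩ _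
    have he : (DyadicRectangle.around a b p).haar p * (DyadicRectangle.around a b p).haar z =
        (if a < a' then (2 : ℝ) ^ a else if a = a' then -2 ^ a else 0) *
        (if b < b' then (2 : ℝ) ^ b else if b = b' then -2 ^ b else 0) := by
      have e1 := DyadicInterval.haar_around_mul (a := a) h1 h1'
      have e2 := DyadicInterval.haar_around_mul (a := b) h2 h2'
      simp only [Nat.cast_lt, Nat.cast_inj, zpow_natCast] at e1 e2
      rw [← e1, ← e2]
      simp only [DyadicRectangle.haar, DyadicRectangle.around]
      ring
    simp only [he, Prod.mk.injEq]
    have h4 : (4 : ℝ) ^ (a + b) = 2 ^ (a + b) * (2 ^ a * 2 ^ b) := by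
      rw [← pow_add, ← mul_pow]; norm_num
    have hpos : (0 : ℝ) < 2 ^ (a + b) * (2 ^ a * 2 ^ b) := by positivity
    rcases lt_trichotomy a a' with ha | rfl | ha <;> rcases lt_trichotomy b b' with hb | rfl | hb
    · simp [ha, hb, ha.ne, hb.ne, hpos.le]
    · simp [ha, ha.ne, h4]
    · simp [ha, ha.ne, hb.ne', hb.not_gt]
    · simp [hb, hb.ne, h4]
    · simp [h4]
    · simp [hb.ne', hb.not_gt]
    · simp [ha.ne', ha.not_gt]
    · simp [ha.ne', ha.not_gt]
    · simp [ha.ne', ha.not_gt]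
  refine le_trans ?_ (Finset.sum_le_sum hpt)
  rw [Finset.sum_sub_distrib, Finset.sum_sub_distrib, Finset.sum_ite_eq' S (a', b'), if_pos hS,
    ← Finset.sum_filter, ← Finset.sum_filter]
  have hA : ∑ w ∈ S with w.1 = a' ∧ w.2 < b', (4 : ℝ) ^ (w.1 + w.2) ≤ 4 ^ a' * (4 ^ b' / 3) := by
    refine le_trans ?_ (mul_le_mul_of_nonneg_left (sum_four_pow_le b') (by positivity))
    rw [Finset.mul_sum]
    refine (Finset.sum_le_sum_of_subset_of_nonneg
      (t := (Finset.range b').image fun b => (a', b)) ?_ fun _ _ _ => by positivity).trans_eq ?_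
    · intro w hw
      obtain ⟨-, hw1, hw2⟩ := Finset.mem_filter.1 hw
      exact Finset.mem_image.2 ⟨w.2, Finset.mem_range.2 hw2, by rw [← hw1]⟩
    · rw [Finset.sum_image (fun x _ y _ h => by simpa using h)]
      exact Finset.sum_congr rfl fun b _ => by rw [pow_add]
  have hB : ∑ w ∈ S with w.2 = b' ∧ w.1 < a', (4 : ℝ) ^ (w.1 + w.2) ≤ 4 ^ b' * (4 ^ a' / 3) := by
    refine le_trans ?_ (mul_le_mul_of_nonneg_left (sum_four_pow_le a') (by positivity))
    rw [Finset.mul_sum]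
    refine (Finset.sum_le_sum_of_subset_of_nonneg
      (t := (Finset.range a').image fun a => (a, b')) ?_ fun _ _ _ => by positivity).trans_eq ?_
    · intro w hw
      obtain ⟨-, hw1, hw2⟩ := Finset.mem_filter.1 hw
      exact Finset.mem_image.2 ⟨w.1, Finset.mem_range.2 hw2, by rw [← hw1]⟩
    · rw [Finset.sum_image (fun x _ y _ h => by simpa using h)]
      exact Finset.sum_congr rfl fun b _ => by rw [pow_add, mul_comm]
  rw [pow_add]
  linarith

theorem exists_split_of_distH_pos {p z : ℝ × ℝ} (hp : p ∈ unitSquare) (hz : z ∈ unitSquare)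
    (h : 0 < distH p z ^ 2) : ∃ a b : ℕ, SameCell a z.1 p.1 ∧ ¬ SameCell (a + 1) z.1 p.1 ∧
      SameCell b z.2 p.2 ∧ ¬ SameCell (b + 1) z.2 p.2 ∧ distH p z ^ 2 = 2 ^ (-(a + b : ℤ)) := by
  obtain ⟨n, hn⟩ := exists_pow_lt_of_lt_one h (show (1 / 2 : ℝ) < 1 by norm_num)
  rw [half_pow_eq] at hn
  have hne1 : z.1 ≠ p.1 := fun he => by
    have := distH_sq_le_of_sameCell (p := p) (q := z) (a := n) (b := 0) (he ▸ .refl _ _)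
      (sameCell_of_mem_Ico hp.2 hz.2 le_rfl)
    rw [add_zero] at this
    linarith
  have hne2 : z.2 ≠ p.2 := fun he => by
    have := distH_sq_le_of_sameCell (p := p) (q := z) (a := 0) (b := n)
      (sameCell_of_mem_Ico hp.1 hz.1 le_rfl) (he ▸ .refl _ _)
    rw [zero_add] at this
    linarith
  obtain ⟨a, ha0, ha, ha'⟩ := exists_split hne1 (sameCell_of_mem_Ico hz.1 hp.1 le_rfl)
  obtain ⟨b, hb0, hb, hb'⟩ := exists_split hne2 (sameCell_of_mem_Ico hz.2 hp.2 le_rfl)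
  lift a to ℕ using ha0
  lift b to ℕ using hb0
  refine ⟨a, b, ha, ha', hb, hb', le_antisymm (distH_sq_le_of_sameCell ha.symm hb.symm)
    (le_distH_sq hp hz fun c d hc hd => ?_)⟩
  have := hc.symm.le_of_split ha'
  have := hd.symm.le_of_split hb'
  omega

theorem IsZSet.card_pos {A : ℝ} {k m : ℕ} {P Z : Finset (ℝ × ℝ)} (hm : 1 ≤ m)
    (hZ : IsZSet A k m P Z) : 0 < Z.card := by
  rcases Nat.eq_zero_or_pos Z.card with h0 | h0
  · have h1 := hZ.card_ge
    rw [h0, Nat.cast_zero, mul_zero] at h1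
    have : (0 : ℝ) < m * 2 ^ (2 * m) := by
      have : (0 : ℝ) < m := by exact_mod_cast hm
      positivity
    linarith
  · exact h0

theorem le_integral_transformMeasure {A : ℝ} (hA : 0 < A) {L : ℕ} (hL : A ≤ 2 ^ L) {k m : ℕ}
    (hk : 1 ≤ k) (hkm : k ≤ m) {P Z : Finset (ℝ × ℝ)} (hP : IsPSet m P) (hZ : IsZSet A k m P Z) :
    ∃ σ : DyadicRectangle → ℝ, (∀ R, |σ R| ≤ 1) ∧ (Function.support σ).Finite ∧
      (6 * 8 ^ L : ℝ)⁻¹ * 2 ^ k ≤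
        |∫ z, transformMeasure σ (uniformMeasure P) z ∂(uniformMeasure Z)| := by
  classical
  -- Since `A ≤ 2 ^ L`, the smallest rectangle containing `z` and `p(z)` has level sum between `2m +
  -- k - L` and `N`.
  set N := 2 * m + k + L with hN
  set S : Finset (ℕ × ℕ) := (Finset.range (N + 1) ×ˢ Finset.range (N + 1)).filter
    fun w => 2 * m + 2 ≤ w.1 + w.2 ∧ w.1 + w.2 ≤ N with hS
  have hmemS : ∀ w : ℕ × ℕ, w ∈ S ↔ 2 * m + 2 ≤ w.1 + w.2 ∧ w.1 + w.2 ≤ N := by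
    intro w
    rw [hS, Finset.mem_filter, Finset.mem_product, Finset.mem_range, Finset.mem_range]
    omega
  set rect : ℝ × ℝ → ℕ × ℕ → DyadicRectangle :=
    fun p w => DyadicRectangle.around w.1 w.2 p with hrect
  have hscale : ∀ p w, (rect p w).fst.scale = -(w.1 : ℤ) ∧ (rect p w).snd.scale = -(w.2 : ℤ) :=
    fun p w => ⟨rfl, rfl⟩
  set T : Finset DyadicRectangle := (P ×ˢ S).image fun w => rect w.1 w.2 with hT
  set σ : DyadicRectangle → ℝ :=
    -- The weight is `|R|⁻¹`, divided by its largest possible value so that `|σ R| ≤ 1`.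
    fun R => if R ∈ T then 2 ^ (-R.fst.scale + -R.snd.scale) / 2 ^ N else 0 with hσ
  have hσT : ∀ R ∉ T, σ R = 0 := fun R hR => by simp [hσ, hR]
  have hσrect : ∀ p ∈ P, ∀ w ∈ S, σ (rect p w) = 2 ^ (w.1 + w.2) / 2 ^ N := by
    intro p hp w hw
    have hmem : rect p w ∈ T := Finset.mem_image.2 ⟨(p, w), Finset.mem_product.2 ⟨hp, hw⟩, rfl⟩
    simp only [hσ, hmem, if_true, hscale, neg_neg]
    rw [← Nat.cast_add, zpow_natCast]
  have hz : ∀ z ∈ Z, (2 : ℝ) ^ (2 * m + k) / (3 * 8 ^ L) ≤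
      ∑ p ∈ P, ∑ R ∈ T, σ R * (R.haar p * R.haar z) := by
    intro z hz
    have hzU := hZ.mem_unitSquare z hz
    obtain ⟨p, ⟨hp, hlt⟩, huniq⟩ := hZ.existsUnique_near z hz
    obtain ⟨hlo, hhi⟩ := hZ.dist_near z hz p hp hlt
    obtain ⟨a, b, h1, h1', h2, h2', hd⟩ := exists_split_of_distH_pos (hP.mem_unitSquare p hp) hzU
      (lt_of_lt_of_le (by positivity) hlo)
    have hn1 : 2 * m + 2 ≤ a + b := by
      rw [hd, half_pow_eq, zpow_lt_zpow_iff_right₀ (one_lt_two (α := ℝ))] at hlt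
      push_cast at hlt
      omega
    have hd' : distH p z ^ 2 = ((2 : ℝ) ^ (a + b))⁻¹ := by
      rw [hd, zpow_neg, ← Nat.cast_add, zpow_natCast]
    rw [hd', one_div, inv_pow] at hlo hhi
    have hn2 : a + b ≤ N := by
      rw [← mul_inv, inv_le_inv₀ (by positivity) (by positivity)] at hlo
      have : (2 : ℝ) ^ (a + b) ≤ 2 ^ N := by
        rw [hN, pow_add _ (2 * m + k), mul_comm _ ((2 : ℝ) ^ L)]
        exact hlo.trans (by gcongr)
      exact (pow_le_pow_iff_right₀ (one_lt_two (α := ℝ))).1 this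
    have hn3 : 2 * m + k ≤ a + b + L := by
      have : (2 : ℝ) ^ (2 * m + k) ≤ 2 ^ (a + b + L) := by
        rw [← div_eq_mul_inv, le_div_iff₀ (by positivity), inv_mul_le_iff₀ (by positivity)] at hhi
        rw [pow_add _ (a + b)]
        exact hhi.trans (by gcongr)
      exact (pow_le_pow_iff_right₀ (one_lt_two (α := ℝ))).1 this
    -- A rectangle of `T` containing `p'` and `z` has area at most `2 ^ (-(2m+2))`, so `p'` would be
    -- a second near point of `z`.
    have hrest : ∀ p' ∈ P, p' ≠ p → ∑ R ∈ T, σ R * (R.haar p' * R.haar z) = 0 := by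
      intro p' hp' hne
      refine Finset.sum_eq_zero fun R hR => ?_
      by_cases hpR : p' ∈ R.toSet
      swap
      · rw [DyadicRectangle.haar_of_notMem hpR]; ring
      by_cases hzR : z ∈ R.toSet
      swap
      · rw [DyadicRectangle.haar_of_notMem hzR]; ring
      refine absurd (huniq p' ⟨hp', ?_⟩) hne
      obtain ⟨w, hw, rfl⟩ := Finset.mem_image.1 hR
      have hw2 := (hmemS _).1 (Finset.mem_product.1 hw).2
      refine (distH_sq_le_area hpR hzR).trans_lt ?_
      rw [DyadicRectangle.area_around, half_pow_eq]
      exact zpow_lt_zpow_right₀ one_lt_two (by push_cast; omega)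
    rw [Finset.sum_eq_single_of_mem p hp hrest]
    have hsub : S.image (rect p) ⊆ T := by
      intro R hR
      obtain ⟨w, hw, rfl⟩ := Finset.mem_image.1 hR
      exact Finset.mem_image.2 ⟨(p, w), Finset.mem_product.2 ⟨hp, hw⟩, rfl⟩
    rw [← Finset.sum_subset hsub, Finset.sum_image]
    · have hsum := le_sum_haar S ((hmemS (a, b)).2 ⟨hn1, hn2⟩) h1 h1' h2 h2'
      have heq : ∑ w ∈ S, σ (rect p w) * ((rect p w).haar p * (rect p w).haar z) =
          (∑ w ∈ S, (2 : ℝ) ^ (w.1 + w.2) * ((rect p w).haar p * (rect p w).haar z)) / 2 ^ N := by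
        rw [Finset.sum_div]
        refine Finset.sum_congr rfl fun w hw => ?_
        rw [hσrect p hp w hw]; ring
      rw [heq]
      refine le_trans ?_ (div_le_div_of_nonneg_right hsum (by positivity))
      rw [div_div, div_le_div_iff₀ (by positivity) (by positivity)]
      have hpw : ((2 : ℝ) ^ (2 * m + k)) * 2 ^ (2 * m + k) ≤ 4 ^ (a + b) * 4 ^ L := by
        rw [← mul_pow, ← pow_add, show (2 : ℝ) * 2 = 4 by norm_num]
        exact pow_le_pow_right₀ (by norm_num) hn3
      have h8 : (8 : ℝ) ^ L = 4 ^ L * 2 ^ L := by rw [← mul_pow]; norm_num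
      rw [hN, pow_add _ (2 * m + k), h8]
      calc (2 : ℝ) ^ (2 * m + k) * (3 * (2 ^ (2 * m + k) * 2 ^ L))
          = 2 ^ (2 * m + k) * 2 ^ (2 * m + k) * (3 * 2 ^ L) := by ring
        _ ≤ 4 ^ (a + b) * 4 ^ L * (3 * 2 ^ L) := by gcongr
        _ = _ := by ring
    · intro w _ w' _ he
      have e1 := (hscale p w).1.symm.trans ((congrArg (·.fst.scale) he).trans (hscale p w').1)
      have e2 := (hscale p w).2.symm.trans ((congrArg (·.snd.scale) he).trans (hscale p w').2)
      exact Prod.ext (by omega) (by omega)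
    · intro R hR hR'
      have hpR : p ∉ R.toSet := by
        intro hpR
        apply hR'
        obtain ⟨w, hw, rfl⟩ := Finset.mem_image.1 hR
        refine Finset.mem_image.2 ⟨w.2, (Finset.mem_product.1 hw).2, ?_⟩
        have e1 := DyadicInterval.around_of_mem hpR.1
        have e2 := DyadicInterval.around_of_mem hpR.2
        simp only [hscale, neg_neg] at e1 e2
        exact DyadicRectangle.ext e1 e2
      rw [DyadicRectangle.haar_of_notMem hpR]; ring
  refine ⟨σ, ?_, T.finite_toSet.subset fun R hR => ?_, ?_⟩
  · intro R
    by_cases hR : R ∈ T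
    · obtain ⟨w, hw, rfl⟩ := Finset.mem_image.1 hR
      obtain ⟨hp, hw⟩ := Finset.mem_product.1 hw
      rw [hσrect _ hp _ hw, abs_of_nonneg (by positivity), div_le_one (by positivity)]
      exact pow_le_pow_right₀ one_le_two ((hmemS _).1 hw).2
    · rw [hσT R hR]; simp
  · by_contra hR'
    exact hR (hσT R hR')
  · rw [integral_transformMeasure hσT]
    refine le_trans ?_ (le_abs_self _)
    have hZpos : (0 : ℝ) < Z.card := by exact_mod_cast hZ.card_pos (by omega)
    have hs := Finset.card_nsmul_le_sum Z _ _ hz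
    rw [nsmul_eq_mul] at hs
    rw [hP.card_eq, ← mul_assoc, ← mul_inv, ← div_eq_inv_mul _ ((Z.card : ℝ) * _),
      le_div_iff₀ (by positivity)]
    refine le_trans (le_of_eq ?_) hs
    push_cast
    rw [pow_add _ (2 * m) k, pow_succ]
    field_simp
    ring

/-! ### Joint concentration of the two measures -/

open Classical in
/-- For `m ≥ 4 ^ k`, the product of the two uniform measures of a dyadic rectangle is at most
about `k` times the square of its area. -/
theorem IsZSet.card_mul_card_le {A : ℝ} (hA : 0 < A) {k m : ℕ} (hkm : 4 ^ k ≤ m)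
    {P Z : Finset (ℝ × ℝ)} (hP : IsPSet m P) (hZ : IsZSet A k m P Z) (a b : ℤ) (x : ℝ × ℝ) :
    ((P.filter fun p => SameCell a p.1 x.1 ∧ SameCell b p.2 x.2).card : ℝ) *
      (Z.filter fun z => SameCell a z.1 x.1 ∧ SameCell b z.2 x.2).card ≤
    (A ^ 2 + A ^ 4) * k * (P.card * Z.card * ((2 : ℝ) ^ (-(a + b))) ^ 2) := by
  set NP := P.filter fun p => SameCell a p.1 x.1 ∧ SameCell b p.2 x.2 with hNP
  set NZ := Z.filter fun z => SameCell a z.1 x.1 ∧ SameCell b z.2 x.2 with hNZ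
  set R := DyadicRectangle.around a b x with hR
  have hxR : x ∈ R.toSet := DyadicRectangle.mem_around.2 ⟨.refl _ _, .refl _ _⟩
  have hcount : ((Z : Set (ℝ × ℝ)) ∩ R.toSet).ncard = NZ.card := by
    rw [ncard_inter_toSet Z R hxR]
    simp only [hR, DyadicRectangle.around, DyadicInterval.around, neg_neg, hNZ]
  have hcard : (P.card : ℝ) = 2 * 2 ^ (2 * m) := by
    rw [hP.card_eq, pow_succ]; push_cast; ring
  have hZge := hZ.card_ge
  have hk0 : (0 : ℝ) ≤ k := k.cast_nonneg
  set t : ℝ := 2 ^ (-(a + b)) with ht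
  have htpos : 0 < t := by positivity
  rcases le_or_gt (a + b) (2 * m + 1) with hab | hab
  · have h1 : (NP.card : ℝ) ≤ P.card * t := by
      obtain ⟨d, hd⟩ := Int.eq_ofNat_of_zero_le (show 0 ≤ 2 * m + 1 - b - a by omega)
      have := card_cell_le P Prod.fst Prod.snd a b d 1 x.1 x.2 fun y => by
        refine Finset.card_le_one.2 fun p hp q hq => ?_
        obtain ⟨hpP, hp1, hp2⟩ := Finset.mem_filter.1 hp
        obtain ⟨hqP, hq1, hq2⟩ := Finset.mem_filter.1 hq
        exact hP.isNet.eq_of_sameCell p hpP q hqP (a + d) b (hp1.trans hq1.symm)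
          (hp2.trans hq2.symm) (by omega)
      have h2 : (NP.card : ℝ) ≤ 2 ^ d := by exact_mod_cast this.trans_eq (one_mul _)
      refine h2.trans_eq ?_
      rw [hP.card_eq, ht]
      push_cast
      rw [← zpow_natCast, ← zpow_natCast, ← zpow_add₀ two_ne_zero]
      congr 1
      push_cast
      omega
    have h2 : (NZ.card : ℝ) ≤ A * (2 ^ (2 * m) * m * k * t) := by
      rw [← hcount, ht, ← DyadicRectangle.area_around a b x]
      refine hZ.card_large R ?_
      rw [DyadicRectangle.area_around, half_pow_eq]
      exact zpow_le_zpow_right₀ one_le_two (by push_cast; omega)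
    have h3 : (NZ.card : ℝ) ≤ A ^ 2 * k * (Z.card * t) := by
      refine h2.trans ?_
      calc A * (2 ^ (2 * m) * m * k * t) = A * k * t * (m * 2 ^ (2 * m)) := by ring
        _ ≤ A * k * t * (A * Z.card) := by gcongr
        _ = _ := by ring
    calc (NP.card : ℝ) * NZ.card ≤ (P.card * t) * (A ^ 2 * k * (Z.card * t)) := by gcongr
      _ = A ^ 2 * k * (P.card * Z.card * t ^ 2) := by ring
      _ ≤ _ := by
        gcongr
        have : 0 < A ^ 4 := by positivity
        linarith
  · rcases NP.eq_empty_or_nonempty with h0 | ⟨p, hp⟩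
    · rw [h0]; simp; positivity
    rcases NZ.eq_empty_or_nonempty with h0 | ⟨z, hz⟩
    · rw [h0]; simp; positivity
    obtain ⟨hpP, hp1, hp2⟩ := Finset.mem_filter.1 hp
    obtain ⟨hzZ, hz1, hz2⟩ := Finset.mem_filter.1 hz
    have h1 : NP.card ≤ 1 := by
      refine Finset.card_le_one.2 fun p hp q hq => ?_
      obtain ⟨hpP, hp1, hp2⟩ := Finset.mem_filter.1 hp
      obtain ⟨hqP, hq1, hq2⟩ := Finset.mem_filter.1 hq
      exact hP.isNet.eq_of_sameCell p hpP q hqP a b (hp1.trans hq1.symm)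
        (hp2.trans hq2.symm) (by omega)
    have h1' : (NP.card : ℝ) ≤ 1 := by exact_mod_cast h1
    have h2 : (NZ.card : ℝ) ≤ A * k := by
      rw [← hcount]
      refine hZ.card_small R ?_ ⟨p, hpP, DyadicRectangle.mem_around.2 ⟨hp1, hp2⟩⟩
      rw [DyadicRectangle.area_around, half_pow_eq]
      exact zpow_le_zpow_right₀ one_le_two (by push_cast; omega)
    have hd : distH p z ^ 2 ≤ t :=
      distH_sq_le_of_sameCell (hp1.trans hz1.symm) (hp2.trans hz2.symm)
    have h3 := ((hZ.dist_near z hzZ p hpP (hd.trans_lt (by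
      rw [ht, half_pow_eq]
      exact zpow_lt_zpow_right₀ one_lt_two (by push_cast; omega)))).1).trans hd
    -- A small cell meeting both sets has area at least about `2 ^ (-2m-k)`. Squaring this costs `4
    -- ^ k`, which the factor `m` in `card_ge` absorbs because `m ≥ 4 ^ k`.
    have h4 : 1 ≤ A * (2 ^ (2 * m) * 2 ^ k * t) := by
      rw [one_div, inv_pow, ← mul_inv, inv_le_iff_one_le_mul₀ (by positivity), pow_add] at h3
      calc (1 : ℝ) ≤ _ := h3
        _ = _ := by ring
    have h5 : 1 ≤ A ^ 2 * (2 ^ (2 * m) * 2 ^ (2 * m) * 4 ^ k * t ^ 2) := by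
      have h6 : (4 : ℝ) ^ k = 2 ^ k * 2 ^ k := by rw [← mul_pow]; norm_num
      calc (1 : ℝ) ≤ (A * (2 ^ (2 * m) * 2 ^ k * t)) ^ 2 := one_le_pow₀ h4
        _ = _ := by rw [h6]; ring
    have h7 : (4 : ℝ) ^ k * 2 ^ (2 * m) ≤ A * Z.card := by
      refine le_trans ?_ hZge
      gcongr
      exact_mod_cast hkm
    calc (NP.card : ℝ) * NZ.card ≤ 1 * (A * k) := by gcongr
      _ ≤ A * k * (2 * (A ^ 2 * (2 ^ (2 * m) * 2 ^ (2 * m) * 4 ^ k * t ^ 2))) := by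
        rw [one_mul]
        exact le_mul_of_one_le_right (by positivity) (by linarith)
      _ = A ^ 3 * k * (2 * 2 ^ (2 * m)) * t ^ 2 * (4 ^ k * 2 ^ (2 * m)) := by ring
      _ ≤ A ^ 3 * k * (2 * 2 ^ (2 * m)) * t ^ 2 * (A * Z.card) := by gcongr
      _ = A ^ 4 * k * (P.card * Z.card * t ^ 2) := by rw [hcard]; ring
      _ ≤ _ := by
        gcongr
        have : 0 < A ^ 2 := by positivity
        linarith

/-! ### Replacing point masses by bounded densities -/

theorem DyadicInterval.measurableSet_toSet (I : DyadicInterval) : MeasurableSet I.toSet :=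
  measurableSet_Ico

theorem DyadicRectangle.measurableSet_toSet (R : DyadicRectangle) : MeasurableSet R.toSet :=
  R.fst.measurableSet_toSet.prod R.snd.measurableSet_toSet

/-- The density that spreads each point of `F` over its dyadic square of side `2 ^ (-M)`. -/
noncomputable def bump (M : ℕ) (F : Finset (ℝ × ℝ)) (x : ℝ × ℝ) : ℝ :=
  ∑ p ∈ F, (DyadicRectangle.around M M p).toSet.indicator (fun _ => (F.card : ℝ)⁻¹ * 4 ^ M) x

theorem volume_around (M : ℕ) (p : ℝ × ℝ) :
    volume (DyadicRectangle.around M M p).toSet = ENNReal.ofReal ((4 ^ M)⁻¹) := by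
  rw [DyadicRectangle.volume_toSet, DyadicRectangle.area_around, zpow_neg, ← Nat.cast_add,
    zpow_natCast, ← two_mul, pow_mul]
  norm_num

theorem memLp_bump (q : ℝ≥0∞) (M : ℕ) (F : Finset (ℝ × ℝ)) : MemLp (bump M F) q := by
  refine memLp_finsetSum F fun p _ => ?_
  refine memLp_indicator_const q (DyadicRectangle.measurableSet_toSet _) _ (Or.inr ?_)
  rw [volume_around]
  exact ENNReal.ofReal_ne_top

theorem bump_eq_zero {M : ℕ} {F : Finset (ℝ × ℝ)} (hF : ∀ p ∈ F, p ∈ unitSquare) {x : ℝ × ℝ}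
    (hx : x ∉ unitSquare) : bump M F x = 0 := by
  refine Finset.sum_eq_zero fun p hp => Set.indicator_of_notMem (fun hxp => hx ?_) _
  obtain ⟨h1, h2⟩ := DyadicRectangle.mem_around.1 hxp
  exact ⟨h1.mem_Ico (by omega) (hF p hp).1, h2.mem_Ico (by omega) (hF p hp).2⟩

theorem hasCompactSupport_bump {M : ℕ} {F : Finset (ℝ × ℝ)} (hF : ∀ p ∈ F, p ∈ unitSquare) :
    HasCompactSupport (bump M F) := by
  refine HasCompactSupport.intro (K := Set.Icc (0 : ℝ) 1 ×ˢ Set.Icc (0 : ℝ) 1)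
    (isCompact_Icc.prod isCompact_Icc) fun x hx => bump_eq_zero hF fun hx' => hx ?_
  exact ⟨Set.Ico_subset_Icc_self hx'.1, Set.Ico_subset_Icc_self hx'.2⟩

/-- Functions that are constant on the small squares do not see the spreading. -/
theorem integral_bump_mul {M : ℕ} {F : Finset (ℝ × ℝ)} {h : ℝ × ℝ → ℝ}
    (hh : ∀ x y : ℝ × ℝ, SameCell M x.1 y.1 → SameCell M x.2 y.2 → h x = h y) :
    ∫ x, bump M F x * h x = ∫ x, h x ∂(uniformMeasure F) := by
  have heq : ∀ x, bump M F x * h x = ∑ p ∈ F, (DyadicRectangle.around M M p).toSet.indicator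
      (fun _ => (F.card : ℝ)⁻¹ * 4 ^ M * h p) x := by
    intro x
    rw [bump, Finset.sum_mul]
    refine Finset.sum_congr rfl fun p _ => ?_
    by_cases hx : x ∈ (DyadicRectangle.around M M p).toSet
    · rw [Set.indicator_of_mem hx, Set.indicator_of_mem hx]
      obtain ⟨h1, h2⟩ := DyadicRectangle.mem_around.1 hx
      rw [hh x p h1 h2]
    · rw [Set.indicator_of_notMem hx, Set.indicator_of_notMem hx, zero_mul]
  simp_rw [heq]
  rw [integral_finsetSum, integral_uniformMeasure, Finset.mul_sum]
  · refine Finset.sum_congr rfl fun p _ => ?_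
    rw [integral_indicator_const _ (DyadicRectangle.measurableSet_toSet _), Measure.real,
      volume_around, ENNReal.toReal_ofReal (by positivity), smul_eq_mul]
    field_simp
  · intro p _
    refine (integrable_indicator_iff (DyadicRectangle.measurableSet_toSet _)).2
      (integrableOn_const ?_)
    rw [volume_around]
    exact ENNReal.ofReal_ne_top

theorem integral_transform_bump {σ : DyadicRectangle → ℝ} {M : ℕ}
    (hM : ∀ R, σ R ≠ 0 → -R.fst.scale + 1 ≤ M ∧ -R.snd.scale + 1 ≤ M) (P Z : Finset (ℝ × ℝ)) :
    ∫ x, transform σ (bump M P) x * bump M Z x =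
      ∫ z, transformMeasure σ (uniformMeasure P) z ∂(uniformMeasure Z) := by
  have hhaar : ∀ R, σ R ≠ 0 → ∀ x y : ℝ × ℝ, SameCell M x.1 y.1 → SameCell M x.2 y.2 →
      R.haar x = R.haar y := by
    intro R hR x y h1 h2
    rw [DyadicRectangle.haar, DyadicRectangle.haar,
      DyadicInterval.haar_congr (h1.mono (hM R hR).1),
      DyadicInterval.haar_congr (h2.mono (hM R hR).2)]
  have htr : transform σ (bump M P) = transformMeasure σ (uniformMeasure P) := by
    funext x
    refine tsum_congr fun R => ?_
    by_cases hR : σ R = 0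
    · simp [hR]
    · rw [integral_bump_mul (hhaar R hR)]
  simp_rw [htr, mul_comm _ (bump M Z _)]
  refine integral_bump_mul fun x y h1 h2 => tsum_congr fun R => ?_
  by_cases hR : σ R = 0
  · simp [hR]
  · rw [hhaar R hR x y h1 h2]

open Classical in
theorem volume_around_inter_le {M : ℕ} {I : DyadicInterval} {p x₀ : ℝ}
    (hp : p ∈ Set.Ico (0 : ℝ) 1) (hx₀ : x₀ ∈ Set.Ico (0 : ℝ) 1) (hx₀I : x₀ ∈ I.toSet) :
    volume ((DyadicInterval.around M p).toSet ∩ I.toSet) ≤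
      if SameCell (max 0 (min (-I.scale) M)) p x₀ then
        ENNReal.ofReal (2 ^ (-max (-I.scale) M)) else 0 := by
  split_ifs with h
  · have hlen : ∀ J : DyadicInterval, J.len = 2 ^ (-(-J.scale)) := fun J => by
      rw [neg_neg]; rfl
    rcases max_cases (-I.scale) (M : ℤ) with ⟨he, -⟩ | ⟨he, -⟩ <;> rw [he]
    · rw [← hlen, ← I.volume_toSet]
      exact measure_mono Set.inter_subset_right
    · rw [show (M : ℤ) = -(DyadicInterval.around M p).scale by simp [DyadicInterval.around],
        ← hlen, ← DyadicInterval.volume_toSet]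
      refine (measure_mono Set.inter_subset_left).trans ?_
      simp [DyadicInterval.around]
  · rw [nonpos_iff_eq_zero, ← measure_empty (μ := (volume : Measure ℝ))]
    congr 1
    rw [Set.eq_empty_iff_forall_notMem]
    rintro y ⟨hy, hyI⟩
    apply h
    rcases max_cases 0 (min (-I.scale) (M : ℤ)) with ⟨he, -⟩ | ⟨he, -⟩ <;> rw [he]
    · exact sameCell_of_mem_Ico hp hx₀ le_rfl
    · exact ((DyadicInterval.mem_around.1 hy).symm.mono (min_le_right _ _)).trans
        ((DyadicInterval.sameCell_of_mem hyI hx₀I).mono (min_le_left _ _))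

-- The levels are clipped for counting: sides shorter than `2 ^ (-M)` are not resolved by the
-- densities, and sides longer than `1` see the whole unit interval. The last factor does not clip
-- long sides and so keeps the decay of averages over large rectangles.
open Classical in
theorem average_bump_le {M : ℕ} {F : Finset (ℝ × ℝ)} (hF : ∀ p ∈ F, p ∈ unitSquare)
    {R : DyadicRectangle} {x₀ : ℝ × ℝ} (hx₀ : x₀ ∈ unitSquare) (hx₀R : x₀ ∈ R.toSet) :
    average (bump M F) R ≤ ENNReal.ofReal ((F.card : ℝ)⁻¹ *
      (F.filter fun p => SameCell (max 0 (min (-R.fst.scale) M)) p.1 x₀.1 ∧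
        SameCell (max 0 (min (-R.snd.scale) M)) p.2 x₀.2).card *
      2 ^ (min (-R.fst.scale) (M : ℤ) + min (-R.snd.scale) (M : ℤ))) := by
  set a := -R.fst.scale with ha
  set b := -R.snd.scale with hb
  set κ : ℝ := (F.card : ℝ)⁻¹ * 4 ^ M with hκ
  have hκ0 : 0 ≤ κ := by positivity
  set ρ : ℝ := 2 ^ (-max a M) * 2 ^ (-max b M) with hρ
  have hρ0 : 0 ≤ ρ := by positivity
  set G := F.filter fun p => SameCell (max 0 (min a M)) p.1 x₀.1 ∧
        SameCell (max 0 (min b M)) p.2 x₀.2 with hG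
  have hint : ∫⁻ x in R.toSet, ‖bump M F x‖ₑ ≤ ENNReal.ofReal (κ * (G.card * ρ)) := by
    calc ∫⁻ x in R.toSet, ‖bump M F x‖ₑ
        ≤ ∫⁻ x in R.toSet, ∑ p ∈ F, (DyadicRectangle.around M M p).toSet.indicator
            (fun _ => ENNReal.ofReal κ) x := by
          refine lintegral_mono fun x => (enorm_sum_le _ _).trans (Finset.sum_le_sum fun p _ => ?_)
          rw [enorm_indicator_eq_indicator_enorm, ← hκ, Real.enorm_of_nonneg hκ0]
      _ = ∑ p ∈ F, ENNReal.ofReal κ * volume ((DyadicRectangle.around M M p).toSet ∩ R.toSet) := by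
          rw [lintegral_finsetSum _ fun p _ =>
            measurable_const.indicator (DyadicRectangle.measurableSet_toSet _)]
          refine Finset.sum_congr rfl fun p _ => ?_
          rw [lintegral_indicator_const (DyadicRectangle.measurableSet_toSet _),
            Measure.restrict_apply (DyadicRectangle.measurableSet_toSet _)]
      _ ≤ ∑ p ∈ F, ENNReal.ofReal κ * (if SameCell (max 0 (min a M)) p.1 x₀.1 ∧
            SameCell (max 0 (min b M)) p.2 x₀.2 then ENNReal.ofReal ρ else 0) := by
          refine Finset.sum_le_sum fun p hp => mul_le_mul_right ?_ _
          simp only [DyadicRectangle.toSet, DyadicRectangle.around]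
          rw [Set.prod_inter_prod, Measure.volume_eq_prod, Measure.prod_prod]
          refine (mul_le_mul' (volume_around_inter_le (hF p hp).1 hx₀.1 hx₀R.1)
            (volume_around_inter_le (hF p hp).2 hx₀.2 hx₀R.2)).trans_eq ?_
          rw [ite_and, hρ, ENNReal.ofReal_mul (by positivity), ← ha, ← hb]
          split_ifs <;> simp
      _ = ENNReal.ofReal (κ * (G.card * ρ)) := by
          rw [← Finset.mul_sum, ← Finset.sum_filter, Finset.sum_const, nsmul_eq_mul,
            ENNReal.ofReal_mul (p := κ) hκ0, ENNReal.ofReal_mul (p := (G.card : ℝ)) (by positivity),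
            ENNReal.ofReal_natCast]
  have harea := R.area_pos
  rw [average, R.volume_toSet, ← ENNReal.ofReal_inv_of_pos harea]
  refine (mul_le_mul_right hint _).trans ?_
  rw [← ENNReal.ofReal_mul (by positivity)]
  apply ENNReal.ofReal_le_ofReal
  apply le_of_eq
  have h4 : (4 : ℝ) ^ M = 2 ^ ((M : ℤ) + M) := by
    rw [← Nat.cast_add, zpow_natCast, ← two_mul, pow_mul]; norm_num
  have hpow : R.area⁻¹ * (4 ^ M * ρ) =
      2 ^ (min a (M : ℤ) + min b (M : ℤ)) := by
    rw [R.area_eq, ← zpow_neg, neg_neg, h4, hρ, ← zpow_add₀ two_ne_zero, ← zpow_add₀ two_ne_zero,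
      ← zpow_add₀ two_ne_zero]
    congr 1
    have := min_add_max a M
    have := min_add_max b M
    omega
  rw [← hpow, hκ]
  ring

theorem average_bump_eq_zero {M : ℕ} {F : Finset (ℝ × ℝ)} (hF : ∀ p ∈ F, p ∈ unitSquare)
    {R : DyadicRectangle} (hR : ∀ x ∈ R.toSet, x ∉ unitSquare) : average (bump M F) R = 0 := by
  rw [average, setLIntegral_congr_fun (g := fun _ => 0) R.measurableSet_toSet
    (fun x hx => by simp [bump_eq_zero hF (hR x hx)])]
  simp

/-! ### Upper bound for sparse forms -/

/-- A dyadic interval that meets `[0, 1)` is long only if it is far from most of its points. -/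
theorem sq_mul_le_two {I : DyadicInterval} {x x₀ : ℝ} (hx₀ : x₀ ∈ Set.Ico (0 : ℝ) 1)
    (hx₀I : x₀ ∈ I.toSet) (hx : x ∈ I.toSet) :
    ((2 : ℝ) ^ (min (-I.scale) 0)) ^ 2 * (1 + x ^ 2) ≤ 2 := by
  have hs := DyadicInterval.sameCell_of_mem hx hx₀I
  rcases le_or_gt 0 (-I.scale) with h | h
  · have hxI := hs.mem_Ico h hx₀
    rw [min_eq_right h, zpow_zero]
    nlinarith [hxI.1, hxI.2]
  · rw [min_eq_left h.le]
    set t : ℝ := 2 ^ (-I.scale) with ht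
    have ht0 : 0 < t := by positivity
    have ht1 : t ≤ 1 := zpow_le_one_of_nonpos₀ one_le_two h.le
    unfold SameCell at hs
    rw [Int.floor_eq_zero_iff.2 (show x₀ * t ∈ Set.Ico (0 : ℝ) 1 from
      ⟨mul_nonneg hx₀.1 ht0.le, by nlinarith [hx₀.1, hx₀.2]⟩)] at hs
    obtain ⟨h1, h2⟩ := Int.floor_eq_zero_iff.1 hs
    have : (x * t) ^ 2 ≤ 1 := by nlinarith
    nlinarith

/-- An integrable weight on the plane. -/
noncomputable def cauchyWeight (x : ℝ × ℝ) : ℝ := (1 + x.1 ^ 2)⁻¹ * (1 + x.2 ^ 2)⁻¹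

theorem integrable_cauchyWeight : Integrable cauchyWeight :=
  integrable_inv_one_add_sq.mul_prod integrable_inv_one_add_sq

instance : Countable DyadicInterval :=
  Function.Injective.countable (f := fun I => (I.scale, I.pos)) fun _ _ h =>
    DyadicInterval.ext (Prod.ext_iff.1 h).1 (Prod.ext_iff.1 h).2

instance : Countable DyadicRectangle :=
  Function.Injective.countable (f := fun R => (R.fst, R.snd)) fun _ _ h =>
    DyadicRectangle.ext (Prod.ext_iff.1 h).1 (Prod.ext_iff.1 h).2

/-- Sparse families may contain arbitrarily large rectangles, so a constant bound would not sum over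
the plane. The decay from long sides gives a bound by an integrable weight at every point of `R`. -/
theorem IsZSet.average_mul_average_le {A : ℝ} (hA : 0 < A) {k m : ℕ} (hkm : 4 ^ k ≤ m)
    {P Z : Finset (ℝ × ℝ)} (hP : IsPSet m P) (hZ : IsZSet A k m P Z) (M : ℕ)
    {R : DyadicRectangle} {x : ℝ × ℝ} (hx : x ∈ R.toSet) :
    average (bump M P) R * average (bump M Z) R ≤
      ENNReal.ofReal ((A ^ 2 + A ^ 4) * k * (4 * cauchyWeight x)) := by
  classical
  by_cases hR : ∀ x ∈ R.toSet, x ∉ unitSquare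
  · rw [average_bump_eq_zero hP.mem_unitSquare hR, zero_mul]
    exact zero_le
  push Not at hR
  obtain ⟨x₀, hx₀R, hx₀⟩ := hR
  refine (mul_le_mul' (average_bump_le hP.mem_unitSquare hx₀ hx₀R)
    (average_bump_le hZ.mem_unitSquare hx₀ hx₀R)).trans ?_
  rw [← ENNReal.ofReal_mul (by positivity)]
  apply ENNReal.ofReal_le_ofReal
  have hcount := hZ.card_mul_card_le hA hkm hP (max 0 (min (-R.fst.scale) M))
    (max 0 (min (-R.snd.scale) M)) x₀
  have w1 := sq_mul_le_two hx₀.1 hx₀R.1 hx.1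
  have w2 := sq_mul_le_two hx₀.2 hx₀R.2 hx.2
  set a := -R.fst.scale
  set b := -R.snd.scale
  set nP : ℝ := ((P.filter fun p => SameCell (max 0 (min a M)) p.1 x₀.1 ∧
        SameCell (max 0 (min b M)) p.2 x₀.2).card : ℝ)
  set nZ : ℝ := ((Z.filter fun p => SameCell (max 0 (min a M)) p.1 x₀.1 ∧
        SameCell (max 0 (min b M)) p.2 x₀.2).card : ℝ)
  have hm : 1 ≤ m := le_trans (Nat.one_le_pow _ _ (by norm_num)) hkm
  have hZpos : (0 : ℝ) < Z.card := by exact_mod_cast hZ.card_pos hm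
  have hPpos : (0 : ℝ) < P.card := by rw [hP.card_eq]; positivity
  have hexp : (2 : ℝ) ^ (-(max 0 (min a (M : ℤ)) + max 0 (min b (M : ℤ)))) *
      2 ^ (min a (M : ℤ) + min b (M : ℤ)) = 2 ^ (min a 0) * 2 ^ (min b 0) := by
    rw [← zpow_add₀ two_ne_zero, ← zpow_add₀ two_ne_zero]
    congr 1
    omega
  set s : ℝ := 2 ^ (-(max 0 (min a (M : ℤ)) + max 0 (min b (M : ℤ))))
  set e : ℝ := 2 ^ (min a (M : ℤ) + min b (M : ℤ))
  have hw : ∀ y u : ℝ, u ^ 2 * (1 + y ^ 2) ≤ 2 → u ^ 2 ≤ 2 * (1 + y ^ 2)⁻¹ := fun y u h => by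
    rw [← div_eq_mul_inv, le_div_iff₀ (by positivity)]
    exact h
  calc (P.card : ℝ)⁻¹ * nP * e * ((Z.card : ℝ)⁻¹ * nZ * e)
      = (P.card : ℝ)⁻¹ * (Z.card : ℝ)⁻¹ * e ^ 2 * (nP * nZ) := by ring
    _ ≤ (P.card : ℝ)⁻¹ * (Z.card : ℝ)⁻¹ * e ^ 2 *
        ((A ^ 2 + A ^ 4) * k * (P.card * Z.card * s ^ 2)) := by gcongr
    _ = (A ^ 2 + A ^ 4) * k * ((s * e) ^ 2) := by field_simp
    _ = (A ^ 2 + A ^ 4) * k * ((2 ^ (min a 0)) ^ 2 * (2 ^ (min b 0)) ^ 2) := by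
        rw [hexp, mul_pow]
    _ ≤ (A ^ 2 + A ^ 4) * k * ((2 * (1 + x.1 ^ 2)⁻¹) * (2 * (1 + x.2 ^ 2)⁻¹)) := by
        gcongr
        · exact hw _ _ w1
        · exact hw _ _ w2
    _ = _ := by rw [cauchyWeight]; ring

theorem IsZSet.sparseForm_le {A : ℝ} (hA : 0 < A) {k m : ℕ} (hkm : 4 ^ k ≤ m)
    {P Z : Finset (ℝ × ℝ)} (hP : IsPSet m P) (hZ : IsZSet A k m P Z) (M : ℕ) {η : ℝ} (hη : 0 < η)
    {S : Set DyadicRectangle} (hS : IsSparse η S) :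
    sparseForm S (bump M P) (bump M Z) ≤ ENNReal.ofReal
      (η⁻¹ * ((A ^ 2 + A ^ 4) * k * (4 * ∫ x, cauchyWeight x))) := by
  obtain ⟨E, hE, hdisj⟩ := hS
  set κ : ℝ := (A ^ 2 + A ^ 4) * k with hκ
  have hκ0 : 0 ≤ κ := by positivity
  set W : ℝ × ℝ → ℝ≥0∞ := fun x => ENNReal.ofReal (κ * (4 * cauchyWeight x)) with hW
  have hcw : ∀ x, 0 ≤ cauchyWeight x := fun x => by rw [cauchyWeight]; positivity
  have hWint : ∫⁻ x, W x = ENNReal.ofReal (κ * (4 * ∫ x, cauchyWeight x)) := by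
    rw [← integral_const_mul, ← integral_const_mul, ofReal_integral_eq_lintegral_ofReal]
    · exact (integrable_cauchyWeight.const_mul _).const_mul _
    · exact Filter.Eventually.of_forall fun x => by have := hcw x; positivity
  -- Sparseness replaces `|R|` by `|E R| / η`, and the pointwise bound is integrated over `E R`.
  -- Disjointness then sums everything to one integral of `W`.
  have hterm : ∀ R : S, average (bump M P) R * average (bump M Z) R *
      volume (R : DyadicRectangle).toSet ≤ ENNReal.ofReal η⁻¹ * ∫⁻ x in E R, W x := by
    rintro ⟨R, hR⟩
    obtain ⟨hmeas, hsub, hvol⟩ := hE R hR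
    have h1 : average (bump M P) R * average (bump M Z) R * volume (E R) ≤
        ∫⁻ x in E R, W x := by
      rw [← setLIntegral_const]
      exact setLIntegral_mono' hmeas fun x hx =>
        hZ.average_mul_average_le hA hkm hP M (hsub hx)
    calc average (bump M P) R * average (bump M Z) R * volume R.toSet
        = ENNReal.ofReal η⁻¹ * (average (bump M P) R * average (bump M Z) R *
            (ENNReal.ofReal η * volume R.toSet)) := by
          rw [mul_left_comm _ (ENNReal.ofReal η), ← mul_assoc (ENNReal.ofReal η⁻¹),
            ← ENNReal.ofReal_mul (by positivity), inv_mul_cancel₀ hη.ne', ENNReal.ofReal_one,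
            one_mul]
      _ ≤ ENNReal.ofReal η⁻¹ * (average (bump M P) R * average (bump M Z) R * volume (E R)) := by
          gcongr
      _ ≤ _ := by gcongr
  calc sparseForm S (bump M P) (bump M Z)
      ≤ ∑' R : S, ENNReal.ofReal η⁻¹ * ∫⁻ x in E R, W x := ENNReal.tsum_le_tsum hterm
    _ = ENNReal.ofReal η⁻¹ * ∫⁻ x in ⋃ R : S, E R, W x := by
        rw [ENNReal.tsum_mul_left, lintegral_iUnion (fun R : S => (hE R R.2).1)]
        intro R R' hne
        exact hdisj R.2 R'.2 fun h => hne (Subtype.ext h)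
    _ ≤ ENNReal.ofReal η⁻¹ * ∫⁻ x, W x := by
        exact mul_le_mul_right (setLIntegral_le_lintegral _ _) _
    _ = _ := by rw [hWint, ← ENNReal.ofReal_mul (by positivity)]

theorem exists_linear_lt_exponential (B : ℝ) {c : ℝ} (hc : 0 < c) :
    ∃ k : ℕ, 1 ≤ k ∧ B * k < c * 2 ^ k := by
  have h := tendsto_pow_const_div_const_pow_of_one_lt 1 (one_lt_two (α := ℝ))
  have hB : 0 < |B| + 1 := by positivity
  obtain ⟨k, hk, hk1⟩ := ((h.eventually (gt_mem_nhds (div_pos hc hB))).and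
    (Filter.eventually_ge_atTop 1)).exists
  refine ⟨k, hk1, ?_⟩
  rw [pow_one, div_lt_div_iff₀ (by positivity) hB] at hk
  have : (0 : ℝ) ≤ k := k.cast_nonneg
  nlinarith [le_abs_self B]

/-! ### Failure of sparse domination -/

theorem not_sparse_dominated {A : ℝ} (hA : 0 < A)
    (hAZ : ∀ k m : ℕ, 1 ≤ k → k ≤ m → ∀ P : Finset (ℝ × ℝ), IsPSet m P →
      ∃ Z : Finset (ℝ × ℝ), IsZSet A k m P Z) {C : ℝ} (hC : 0 < C) {η : ℝ} (hη : 0 < η) :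
    ∃ σ : DyadicRectangle → ℝ, (∀ R, |σ R| ≤ 1) ∧ (Function.support σ).Finite ∧
      ∃ f g : ℝ × ℝ → ℝ, Integrable f ∧ MemLp f ⊤ ∧ HasCompactSupport f ∧
        Integrable g ∧ MemLp g ⊤ ∧ HasCompactSupport g ∧
        ∀ S : Set DyadicRectangle, IsSparse η S →
          ENNReal.ofReal C * sparseForm S f g <
            ENNReal.ofReal |∫ x, transform σ f x * g x| := by
  obtain ⟨L, hL⟩ := pow_unbounded_of_one_lt A (one_lt_two (α := ℝ))
  have hc : (0 : ℝ) < (6 * 8 ^ L : ℝ)⁻¹ := by positivity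
  obtain ⟨k, hk, hlt⟩ := exists_linear_lt_exponential
    (C * (η⁻¹ * ((A ^ 2 + A ^ 4) * (4 * ∫ x, cauchyWeight x)))) hc
  have hkm : k ≤ 4 ^ k := (Nat.lt_pow_self (by norm_num)).le
  obtain ⟨P, hP⟩ := exists_isPSet (4 ^ k)
  obtain ⟨Z, hZ⟩ := hAZ k (4 ^ k) hk hkm P hP
  obtain ⟨σ, hσ1, hσfin, hσ⟩ := le_integral_transformMeasure hA hL.le hk hkm hP hZ
  -- The `+ 1` is there because a Haar function is constant only on the halves of its interval; the
  -- squares of side `2 ^ (-M)` must fit inside those.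
  obtain ⟨M, hM⟩ := (hσfin.toFinset.image fun R =>
    max (-R.fst.scale + 1) (-R.snd.scale + 1)).exists_le
  have hM' : ∀ R, σ R ≠ 0 → -R.fst.scale + 1 ≤ (M.toNat : ℤ) ∧
      -R.snd.scale + 1 ≤ (M.toNat : ℤ) := by
    intro R hR
    have h1 := max_le_iff.1 (hM _ (Finset.mem_image_of_mem _ (hσfin.mem_toFinset.2 hR)))
    have h2 := Int.self_le_toNat M
    exact ⟨h1.1.trans h2, h1.2.trans h2⟩
  refine ⟨σ, hσ1, hσfin, bump M.toNat P, bump M.toNat Z, memLp_one_iff_integrable.1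
    (memLp_bump _ _ _), memLp_bump _ _ _, hasCompactSupport_bump hP.mem_unitSquare,
    memLp_one_iff_integrable.1 (memLp_bump _ _ _), memLp_bump _ _ _,
    hasCompactSupport_bump hZ.mem_unitSquare, fun S hS => ?_⟩
  rw [integral_transform_bump hM']
  refine (mul_le_mul_right (hZ.sparseForm_le hA le_rfl hP _ hη hS) _).trans_lt ?_
  rw [← ENNReal.ofReal_mul hC.le]
  have hpos : 0 < (6 * 8 ^ L : ℝ)⁻¹ * 2 ^ k := by positivity
  refine (ENNReal.ofReal_lt_ofReal_iff (hpos.trans_le hσ)).2 (lt_of_lt_of_le ?_ hσ)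
  refine lt_of_eq_of_lt ?_ hlt
  ring

end BiParam

theorem theorem4p1 :
    -- the point sets that carry the two measures exist
    (∀ m : ℕ, ∃ P : Finset (ℝ × ℝ), BiParam.IsPSet m P) ∧
    (∃ A : ℝ, 0 < A ∧ ∀ k m : ℕ, 1 ≤ k → k ≤ m →
      ∀ P : Finset (ℝ × ℝ), BiParam.IsPSet m P →
        ∃ Z : Finset (ℝ × ℝ), BiParam.IsZSet A k m P Z) ∧
    -- the lower bound for a martingale transform of the measures
    (∀ A : ℝ, 0 < A → ∃ c : ℝ, 0 < c ∧ ∀ k m : ℕ, 1 ≤ k → k ≤ m →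
      ∀ P Z : Finset (ℝ × ℝ), BiParam.IsPSet m P → BiParam.IsZSet A k m P Z →
        ∃ σ : BiParam.DyadicRectangle → ℝ,
          (∀ R, |σ R| ≤ 1) ∧ (Function.support σ).Finite ∧
          c * 2 ^ k ≤ |∫ z, BiParam.transformMeasure σ (BiParam.uniformMeasure P) z
            ∂(BiParam.uniformMeasure Z)|) ∧
    -- failure of uniform sparse domination
    (∀ C : ℝ, 0 < C → ∀ η : ℝ, 0 < η →
      ∃ σ : BiParam.DyadicRectangle → ℝ,
        (∀ R, |σ R| ≤ 1) ∧ (Function.support σ).Finite ∧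
        ∃ f g : ℝ × ℝ → ℝ,
          MeasureTheory.Integrable f ∧ MeasureTheory.MemLp f ⊤ ∧ HasCompactSupport f ∧
          MeasureTheory.Integrable g ∧ MeasureTheory.MemLp g ⊤ ∧ HasCompactSupport g ∧
          ∀ S : Set BiParam.DyadicRectangle, BiParam.IsSparse η S →
            ENNReal.ofReal C * BiParam.sparseForm S f g <
              ENNReal.ofReal |∫ x, BiParam.transform σ f x * g x|) := by
  have hZ : ∀ k m : ℕ, 1 ≤ k → k ≤ m → ∀ P : Finset (ℝ × ℝ), BiParam.IsPSet m P →
      ∃ Z : Finset (ℝ × ℝ), BiParam.IsZSet 8 k m P Z :=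
    fun k m hk hkm P hP => BiParam.exists_isZSet_of_isPSet hk hkm hP
  refine ⟨BiParam.exists_isPSet, ⟨8, by norm_num, hZ⟩, fun A hA => ?_,
    fun C hC η hη => BiParam.not_sparse_dominated (by norm_num) hZ hC hη⟩
  obtain ⟨L, hL⟩ := pow_unbounded_of_one_lt A (one_lt_two (α := ℝ))
  exact ⟨(6 * 8 ^ L : ℝ)⁻¹, by positivity, fun k m hk hkm P Z hP hZ =>
    BiParam.le_integral_transformMeasure hA hL.le hk hkm hP hZ⟩
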